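/- Consider a two-receiver discrete memoryless broadcast channel with finite input alphabet $\mathcal X$, finite output alphabets $\mathcal Y_1,\mathcal Y_2$ and transition probabilities $p(y_1,y_2\mid x)$, used with private messages only. A pair $(R_1,R_2)$ with $R_1,R_2\ge 0$ is achievable if there are codes of length $n=0,1,2,\dots$ with $\lceil e^{nR_1}\rceil$ messages for receiver 1 and $\lceil e^{nR_2}\rceil$ messages for receiver 2, each consisting of an encoder of the message pair and one decoder per receiver, whose average probability of error (for independent uniform messages, an error being that at least one receiver decodes its own message wrongly) tends to $0$ as $n\to\infty$. The capacity region is the closure in $\mathbb R^2$ of the set of achievable pairs. Mutual informations are in nats and take values in $[0,\infty]$: $I(A;B\mid C)$ is the relative entropy of $P_{ABC}$ with respect to $P_C\,P_{A|C}\,P_{B|C}$. Then for every pair $(R_1,R_2)$ in the capacity region there are random variables $U,V,W_1,W_2$ (real-valued, which covers all standard Borel and in particular all discrete alphabets), $X\in\mathcal X$, $Y_1\in\mathcal Y_1$, $Y_2\in\mathcal Y_2$ on a common probability space such that $(U,V,W_1,W_2)\to X\to(Y_1,Y_2)$ is a Markov chain, the conditional distribution of $(Y_1,Y_2)$ given $X$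 is $p(y_1,y_2\mid x)$, $U$ and $V$ are independent, \begin{align*} I(U;Y_1|W_1) &= I(U;Y_1|V,W_1),\\ I(V;Y_2|W_2) &= I(V;Y_2|U,W_2),\\ I(U;V|W_1,W_2,Y_1) &= I(U;V|W_1,W_2,Y_2),\\ I(W_2;Y_1|W_1) &= I(W_1;Y_2|W_2),\\ I(W_2;Y_1|U,W_1) &= I(W_1;Y_2|U,W_2),\\ I(W_2;Y_1|V,W_1) &= I(W_1;Y_2|V,W_2),\\ I(W_2;Y_1|U,V,W_1) &= I(W_1;Y_2|U,V,W_2), \end{align*} and \[ R_1\le I(U;Y_1|W_1),\qquad R_2\le I(V;Y_2|W_2). \] Moreover, the third equality also holds in the difference form $I(U;Y_1|V,W_1,W_2)-I(U;Y_1|W_1,W_2)=I(U;Y_2|V,W_1,W_2)-I(U;Y_2|W_1,W_2)$, which keeps its content when both of its sides are infinite. -/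

import Mathlib

open MeasureTheory ProbabilityTheory Filter Topology

noncomputable section

namespace BroadcastChannel

/-! ### The two-receiver discrete memoryless broadcast channel -/

section Channel

variable {𝒳 𝒴₁ 𝒴₂ : Type*}

/-- A code of length `n` for a two-receiver broadcast channel with private messages only:
`M₁` messages for the first receiver, `M₂` messages for the second one, an encoder that sees both
messages, and one decoder per receiver, which sees only the output of this receiver. -/
structure Code (𝒳 𝒴₁ 𝒴₂ : Type*) (n M₁ M₂ : ℕ) where
  /-- The encoder. -/
  enc : Fin M₁ → Fin M₂ → (Fin n → 𝒳)
  /-- The decoder of the first receiver. -/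
  dec₁ : (Fin n → 𝒴₁) → Fin M₁
  /-- The decoder of the second receiver. -/
  dec₂ : (Fin n → 𝒴₂) → Fin M₂

/-- Average probability of error of a code when it is used over the memoryless channel with
transition probabilities `p x (y₁, y₂)`, the two messages being independent and uniformly
distributed. An error occurs when at least one receiver decodes its own message wrongly. -/
def Code.errorProb [Fintype 𝒴₁] [Fintype 𝒴₂] (p : 𝒳 → PMF (𝒴₁ × 𝒴₂)) {n M₁ M₂ : ℕ}
    (c : Code 𝒳 𝒴₁ 𝒴₂ n M₁ M₂) : ℝ :=
  (∑ m₁ : Fin M₁, ∑ m₂ : Fin M₂, ∑ y : Fin n → 𝒴₁ × 𝒴₂,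
    if c.dec₁ (fun i => (y i).1) ≠ m₁ ∨ c.dec₂ (fun i => (y i).2) ≠ m₂ then
      ∏ i, (p (c.enc m₁ m₂ i) (y i)).toReal
    else 0) / ((M₁ : ℝ) * (M₂ : ℝ))

/-- The rate pair `(R₁, R₂)` (in nats per channel use) is achievable: there are codes of length
`n` with `⌈exp (n R₁)⌉` and `⌈exp (n R₂)⌉` messages whose average probability of error tends
to `0`. -/
def Achievable [Fintype 𝒴₁] [Fintype 𝒴₂] (p : 𝒳 → PMF (𝒴₁ × 𝒴₂)) (R₁ R₂ : ℝ) : Prop :=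
  0 ≤ R₁ ∧ 0 ≤ R₂ ∧
    ∃ c : ∀ n : ℕ, Code 𝒳 𝒴₁ 𝒴₂ n ⌈Real.exp (n * R₁)⌉₊ ⌈Real.exp (n * R₂)⌉₊,
      Tendsto (fun n => (c n).errorProb p) atTop (𝓝 0)

/-- The capacity region: the closure of the set of achievable rate pairs. -/
def capacityRegion [Fintype 𝒴₁] [Fintype 𝒴₂] (p : 𝒳 → PMF (𝒴₁ × 𝒴₂)) : Set (ℝ × ℝ) :=
  closure {R | Achievable p R.1 R.2}

end Channel

/-! ### Conditional mutual information -/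

/-- Conditional mutual information `I(A; B | C) ∈ [0, ∞]` (in nats), the relative entropy
`D(P_{C,A,B} ‖ P_C P_{A|C} P_{B|C})`. -/
def condMutualInfo {Ω α β γ : Type*} [MeasurableSpace Ω]
    [MeasurableSpace α] [StandardBorelSpace α] [Nonempty α]
    [MeasurableSpace β] [StandardBorelSpace β] [Nonempty β] [MeasurableSpace γ]
    (μ : Measure Ω) [IsFiniteMeasure μ] (A : Ω → α) (B : Ω → β) (C : Ω → γ) : ENNReal :=
  InformationTheory.klDiv (μ.map fun ω => (C ω, (A ω, B ω)))
    ((μ.map C).compProd ((condDistrib A C μ).prod (condDistrib B C μ)))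

/-! ### The outer bound -/

section OuterBound

variable {𝒳 𝒴₁ 𝒴₂ : Type*} [MeasurableSpace 𝒳]
  [MeasurableSpace 𝒴₁] [StandardBorelSpace 𝒴₁] [Nonempty 𝒴₁]
  [MeasurableSpace 𝒴₂] [StandardBorelSpace 𝒴₂] [Nonempty 𝒴₂]

/-- The conditions on the joint distribution of `(U, V, W₁, W₂, X, Y₁, Y₂)`. The auxiliary
variables are real valued, which covers all standard Borel alphabets, in particular all finite and
countable ones. -/
structure IsAdmissible (p : 𝒳 → PMF (𝒴₁ × 𝒴₂)) {Ω : Type*} [MeasurableSpace Ω]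
    (μ : Measure Ω) [IsProbabilityMeasure μ] (U V W₁ W₂ : Ω → ℝ)
    (X : Ω → 𝒳) (Y₁ : Ω → 𝒴₁) (Y₂ : Ω → 𝒴₂) : Prop where
  measurable_U : Measurable U
  measurable_V : Measurable V
  measurable_W₁ : Measurable W₁
  measurable_W₂ : Measurable W₂
  measurable_X : Measurable X
  measurable_Y₁ : Measurable Y₁
  measurable_Y₂ : Measurable Y₂
  /-- `(U, V, W₁, W₂) → X → (Y₁, Y₂)` is a Markov chain, and the conditional distribution of
  `(Y₁, Y₂)` given `X` is the channel `p`. -/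
  markov : ∀ B : Set (ℝ × ℝ × ℝ × ℝ), MeasurableSet B → ∀ (x : 𝒳) (y : 𝒴₁ × 𝒴₂),
    μ {ω | (U ω, V ω, W₁ ω, W₂ ω) ∈ B ∧ X ω = x ∧ (Y₁ ω, Y₂ ω) = y} =
      μ {ω | (U ω, V ω, W₁ ω, W₂ ω) ∈ B ∧ X ω = x} * p x y
  indep : IndepFun U V μ
  eq₁ : condMutualInfo μ U Y₁ W₁ = condMutualInfo μ U Y₁ (fun ω => (V ω, W₁ ω))
  eq₂ : condMutualInfo μ V Y₂ W₂ = condMutualInfo μ V Y₂ (fun ω => (U ω, W₂ ω))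
  eq₃ : condMutualInfo μ U V (fun ω => (W₁ ω, W₂ ω, Y₁ ω)) =
    condMutualInfo μ U V (fun ω => (W₁ ω, W₂ ω, Y₂ ω))
  eq₄ : condMutualInfo μ W₂ Y₁ W₁ = condMutualInfo μ W₁ Y₂ W₂
  eq₅ : condMutualInfo μ W₂ Y₁ (fun ω => (U ω, W₁ ω)) =
    condMutualInfo μ W₁ Y₂ (fun ω => (U ω, W₂ ω))
  eq₆ : condMutualInfo μ W₂ Y₁ (fun ω => (V ω, W₁ ω)) =
    condMutualInfo μ W₁ Y₂ (fun ω => (V ω, W₂ ω))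
  eq₇ : condMutualInfo μ W₂ Y₁ (fun ω => (U ω, V ω, W₁ ω)) =
    condMutualInfo μ W₁ Y₂ (fun ω => (U ω, V ω, W₂ ω))
  /-- The difference form of `eq₃`. By the chain rule,
  `I(U; V | W₁, W₂, Yᵢ) = I(U; V | W₁, W₂) + I(U; Yᵢ | V, W₁, W₂) - I(U; Yᵢ | W₁, W₂)`, so this
  is `eq₃` when `I(U; V | W₁, W₂)` is finite; it keeps the content of `eq₃` in the case where both
  sides of `eq₃` are infinite. All four terms here are finite when the output alphabets are. -/
  eq₃_diff :
    condMutualInfo μ U Y₁ (fun ω => (V ω, W₁ ω, W₂ ω)) +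
        condMutualInfo μ U Y₂ (fun ω => (W₁ ω, W₂ ω)) =
      condMutualInfo μ U Y₂ (fun ω => (V ω, W₁ ω, W₂ ω)) +
        condMutualInfo μ U Y₁ (fun ω => (W₁ ω, W₂ ω))

/-- The set of rate pairs `(R₁, R₂)` with `R₁ ≤ I(U; Y₁ | W₁)` and `R₂ ≤ I(V; Y₂ | W₂)` for some
admissible `(U, V, W₁, W₂, X, Y₁, Y₂)`. -/
def outerRegion (p : 𝒳 → PMF (𝒴₁ × 𝒴₂)) : Set (ℝ × ℝ) :=
  {R | ∃ (Ω : Type) (_ : MeasurableSpace Ω) (μ : Measure Ω) (_ : IsProbabilityMeasure μ)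
    (U V W₁ W₂ : Ω → ℝ) (X : Ω → 𝒳) (Y₁ : Ω → 𝒴₁) (Y₂ : Ω → 𝒴₂),
    IsAdmissible p μ U V W₁ W₂ X Y₁ Y₂ ∧
      ENNReal.ofReal R.1 ≤ condMutualInfo μ U Y₁ W₁ ∧
      ENNReal.ofReal R.2 ≤ condMutualInfo μ V Y₂ W₂}

end OuterBound

end BroadcastChannel

end

noncomputable section

namespace BroadcastChannel

open InformationTheory
open scoped ENNReal

/-! ### Conditional mutual information: chain rule and entropies -/

section Information

variable {Ω α β γ δ : Type*} [MeasurableSpace Ω]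
  [MeasurableSpace α] [StandardBorelSpace α] [Nonempty α]
  [MeasurableSpace β] [StandardBorelSpace β] [Nonempty β]
  [MeasurableSpace γ] [MeasurableSpace δ]

/-! The classical converse takes U and V to be the two messages, W₁ the past of Y₁ and W₂ the future
of Y₂ at a uniformly chosen time. Csiszár's sum identity then gives `eq₄` to `eq₇` exactly, while
Fano's inequality gives `eq₁`, `eq₂` and the rate bounds up to an error that vanishes as n grows.
Exact equalities therefore require a limit n → ∞, although the alphabets of these variables grow
with n.

The way out is that every information needed is a difference of entropies H(Yᵢ | S), where S is a
set of auxiliary variables, and that H(Yᵢ | S) is the mean of a continuous function of the posterior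
of X given S. Only the joint law of the sixteen posteriors matters. These laws live on a fixed
compact space, so they have a limit (`exists_tendsto_integral`) along which all the entropies
converge, and coherence of the posteriors survives (`WeaklyCoherent.coherent`).

Conversely, a coherent law of posteriors is realized by actual variables through secret sharing. U,
V, W₁, W₂ are four parties. For each S that contains W₁ or W₂, the posterior κ S, encoded in the
circle group, is split into additive shares among the members of S. A coalition A recovers κ S if S
⊆ A and otherwise sees only uniform noise about it (`shares_shift_add`), so by coherence its
posterior of X is κ A whenever it contains W₁ or W₂. U and V hold noise only, hence are independent.
`mem_outerRegion_of_coherent` collects this; the difference form of `eq₃` is a linear consequence of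
the other equalities. -/

lemma klDiv_map_measurableEquiv {α β : Type*} [MeasurableSpace α] [MeasurableSpace β]
    (e : α ≃ᵐ β) (μ ν : Measure α) [IsFiniteMeasure μ] [IsFiniteMeasure ν] :
    klDiv (μ.map e) (ν.map e) = klDiv μ ν := by
  refine le_antisymm (klDiv_map_le μ ν e.measurable) ?_
  have h := klDiv_map_le (μ.map e) (ν.map e) e.symm.measurable
  simpa [Measure.map_map e.symm.measurable e.measurable] using h

variable {μ : Measure Ω} [IsFiniteMeasure μ] {A : Ω → α} {B : Ω → β} {C : Ω → γ}

/-- `I(A; B | C)` compares the conditional law of `B` given `(C, A)` with the one given `C`. -/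
lemma condMutualInfo_eq_klDiv (hA : Measurable A) (hB : Measurable B) (hC : Measurable C) :
    condMutualInfo μ A B C = klDiv (μ.map fun ω => ((C ω, A ω), B ω))
      ((μ.map fun ω => (C ω, A ω)) ⊗ₘ (condDistrib B C μ).prodMkRight α) := by
  rw [condMutualInfo, ← klDiv_map_measurableEquiv MeasurableEquiv.prodAssoc.symm]
  congr 1
  · rw [Measure.map_map (by fun_prop) (by fun_prop)]
    rfl
  · rw [← compProd_map_condDistrib hA.aemeasurable (X := C)]
    refine Measure.ext_of_lintegral _ fun f hf => ?_
    rw [lintegral_map hf (by fun_prop), Measure.lintegral_compProd (by fun_prop),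
      Measure.lintegral_compProd hf, Measure.lintegral_compProd]
    · refine lintegral_congr fun c => ?_
      rw [Kernel.prod_apply, lintegral_prod _ (by fun_prop)]
      rfl
    · exact hf.lintegral_kernel_prod_right'

/-- The chain rule of relative entropy, with A split off before B. The second term is an information
because the reference law lets B depend on C alone. -/
lemma klDiv_compProd_prodMkRight (hA : Measurable A) (hB : Measurable B) (hC : Measurable C)
    (κ : Kernel γ α) [IsMarkovKernel κ] :
    klDiv (μ.map fun ω => ((C ω, B ω), A ω)) ((μ.map fun ω => (C ω, B ω)) ⊗ₘ κ.prodMkRight β) =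
      klDiv (μ.map fun ω => (C ω, A ω)) (μ.map C ⊗ₘ κ) + condMutualInfo μ A B C := by
  let e : (γ × β) × α ≃ᵐ (γ × α) × β :=
    { toFun := fun x => ((x.1.1, x.2), x.1.2)
      invFun := fun x => ((x.1.1, x.2), x.1.2)
      left_inv := fun _ => rfl
      right_inv := fun _ => rfl
      measurable_toFun := by simp only [Equiv.coe_fn_mk]; fun_prop
      measurable_invFun := by simp only [Equiv.coe_fn_symm_mk]; fun_prop }
  rw [← klDiv_map_measurableEquiv e, condMutualInfo_eq_klDiv hA hB hC]
  have h₁ : (μ.map fun ω => ((C ω, B ω), A ω)).map e =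
      (μ.map fun ω => (C ω, A ω)) ⊗ₘ condDistrib B (fun ω => (C ω, A ω)) μ := by
    rw [compProd_map_condDistrib hB.aemeasurable, Measure.map_map e.measurable (by fun_prop)]
    rfl
  have h₂ : ((μ.map fun ω => (C ω, B ω)) ⊗ₘ κ.prodMkRight β).map e =
      (μ.map C ⊗ₘ κ) ⊗ₘ (condDistrib B C μ).prodMkRight α := by
    rw [← compProd_map_condDistrib hB.aemeasurable (X := C)]
    refine Measure.ext_of_lintegral _ fun f hf => ?_
    have hfe : Measurable fun x => f (e x) := hf.comp e.measurable
    rw [lintegral_map hf e.measurable, Measure.lintegral_compProd hfe,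
      Measure.lintegral_compProd hfe.lintegral_kernel_prod_right', Measure.lintegral_compProd hf,
      Measure.lintegral_compProd hf.lintegral_kernel_prod_right']
    refine lintegral_congr fun c => ?_
    simp only [Kernel.prodMkRight_apply]
    have hm : Measurable fun p : β × α => f (e ((c, p.1), p.2)) :=
      hfe.comp (by fun_prop)
    rw [lintegral_lintegral_swap (f := fun b a => f (e ((c, b), a))) hm.aemeasurable]
    rfl
  rw [h₁, h₂, klDiv_compProd_eq_add]
  rw [compProd_map_condDistrib hB.aemeasurable]

/-- With the true conditional law of A as kernel the first divergence vanishes. The result is the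
mirror image of `condMutualInfo_eq_klDiv`, with A and B exchanged. -/
lemma klDiv_compProd_condDistrib (hA : Measurable A) (hB : Measurable B) (hC : Measurable C) :
    klDiv (μ.map fun ω => ((C ω, B ω), A ω))
      ((μ.map fun ω => (C ω, B ω)) ⊗ₘ (condDistrib A C μ).prodMkRight β) =
      condMutualInfo μ A B C := by
  rw [klDiv_compProd_prodMkRight hA hB hC, compProd_map_condDistrib hA.aemeasurable, klDiv_self,
    zero_add]

lemma condDistrib_comp_measurableEquiv_ae (hA : Measurable A) (hC : Measurable C) (e : γ ≃ᵐ δ) :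
    ∀ᵐ c ∂(μ.map C), condDistrib A (fun ω => e (C ω)) μ (e c) = condDistrib A C μ c := by
  have h := condDistrib_ae_eq_of_measure_eq_compProd (μ := μ) C hA.aemeasurable
    (κ := (condDistrib A (fun ω => e (C ω)) μ).comap e e.measurable) ?_
  · filter_upwards [h] with c hc
    rw [hc]; rfl
  · have h₁ : μ.map (fun ω => (C ω, A ω)) =
        (μ.map (fun ω => (e (C ω), A ω))).map (Prod.map e.symm id) := by
      rw [Measure.map_map (by fun_prop) (by fun_prop)]
      congr 1
      ext ω <;> simp
    rw [h₁, ← compProd_map_condDistrib hA.aemeasurable]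
    refine Measure.ext_of_lintegral _ fun f hf => ?_
    rw [lintegral_map hf (by fun_prop), Measure.lintegral_compProd (by fun_prop),
      Measure.lintegral_compProd hf,
      show (μ.map fun ω => e (C ω)) = (μ.map C).map e by
        rw [Measure.map_map e.measurable hC]; rfl, lintegral_map_equiv]
    simp

/-- Conditional mutual information does not change when the condition is relabelled. -/
lemma condMutualInfo_congr_cond (hA : Measurable A) (hB : Measurable B) (hC : Measurable C)
    (e : γ ≃ᵐ δ) : condMutualInfo μ A B (fun ω => e (C ω)) = condMutualInfo μ A B C := by
  rw [condMutualInfo, condMutualInfo,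
    ← klDiv_map_measurableEquiv (e.prodCongr (MeasurableEquiv.refl (α × β)))
      (μ.map fun ω => (C ω, A ω, B ω))]
  congr 1
  · rw [Measure.map_map (by fun_prop) (by fun_prop)]
    rfl
  · refine Measure.ext_of_lintegral _ fun f hf => ?_
    rw [lintegral_map hf (by fun_prop), Measure.lintegral_compProd hf,
      Measure.lintegral_compProd (by fun_prop),
      show (μ.map fun ω => e (C ω)) = (μ.map C).map e by
        rw [Measure.map_map e.measurable hC]; rfl, lintegral_map_equiv]
    refine lintegral_congr_ae ?_
    filter_upwards [condDistrib_comp_measurableEquiv_ae hA hC e,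
      condDistrib_comp_measurableEquiv_ae hB hC e] with c h₁ h₂
    rw [Kernel.prod_apply, Kernel.prod_apply, h₁, h₂]
    rfl

/-- The two ways to expand `I(A; (B, Y) | C)` by the chain rule agree. -/
lemma condMutualInfo_chain {ε : Type*} [MeasurableSpace ε] [StandardBorelSpace ε] [Nonempty ε]
    {Y : Ω → ε} (hA : Measurable A) (hB : Measurable B) (hC : Measurable C) (hY : Measurable Y) :
    condMutualInfo μ A Y C + condMutualInfo μ A B (fun ω => (C ω, Y ω)) =
      condMutualInfo μ A B C + condMutualInfo μ A Y (fun ω => (C ω, B ω)) := by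
  -- Both sides are the divergence of the joint law from the one in which A depends on C alone.
  -- Nothing is subtracted, so infinite values do no harm.
  have h₁ := klDiv_compProd_prodMkRight (μ := μ) (C := fun ω => (C ω, Y ω)) hA hB (by fun_prop)
    ((condDistrib A C μ).prodMkRight ε)
  have h₂ := klDiv_compProd_prodMkRight (μ := μ) (C := fun ω => (C ω, B ω)) hA hY (by fun_prop)
    ((condDistrib A C μ).prodMkRight β)
  rw [klDiv_compProd_condDistrib hA hY hC] at h₁
  rw [klDiv_compProd_condDistrib hA hB hC] at h₂
  rw [← h₁, ← h₂]
  let e : ((γ × ε) × β) × α ≃ᵐ ((γ × β) × ε) × α :=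
    { toFun := fun x => (((x.1.1.1, x.1.2), x.1.1.2), x.2)
      invFun := fun x => (((x.1.1.1, x.1.2), x.1.1.2), x.2)
      left_inv := fun _ => rfl
      right_inv := fun _ => rfl
      measurable_toFun := by simp only [Equiv.coe_fn_mk]; fun_prop
      measurable_invFun := by simp only [Equiv.coe_fn_symm_mk]; fun_prop }
  rw [← klDiv_map_measurableEquiv e]
  congr 1
  · rw [Measure.map_map e.measurable (by fun_prop)]
    rfl
  · refine Measure.ext_of_lintegral _ fun f hf => ?_
    have hfe : Measurable fun x => f (e x) := hf.comp e.measurable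
    rw [lintegral_map hf e.measurable, Measure.lintegral_compProd hfe,
      Measure.lintegral_compProd hf, lintegral_map hfe.lintegral_kernel_prod_right' (by fun_prop),
      lintegral_map hf.lintegral_kernel_prod_right' (by fun_prop)]
    rfl

end Information

/-! ### Finite-valued variables -/

section Entropy

variable {τ β : Type*} [MeasurableSpace τ] [Fintype β] [MeasurableSpace β]
  [MeasurableSingletonClass β]

/-- Cross-entropy is relative entropy plus entropy. The corrections `e b - k b` contained in `klFun`
cancel because both families have total mass 1. -/
lemma sum_klFun_div_add_sum_negMulLog {β : Type*} [Fintype β] {k e : β → ℝ} (hk : ∀ b, 0 ≤ k b) (hk1 : ∑ b, k b = 1)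
    (he : ∀ b, 0 ≤ e b) (he1 : ∑ b, e b = 1) (hke : ∀ b, e b = 0 → k b = 0) :
    ∑ b, klFun (k b / e b) * e b + ∑ b, Real.negMulLog (k b) = ∑ b, k b * -Real.log (e b) := by
  have h : ∀ b, klFun (k b / e b) * e b + Real.negMulLog (k b) =
      k b * -Real.log (e b) + (e b - k b) := by
    intro b
    rcases (he b).eq_or_lt with h0 | h0
    · simp [← h0, hke b h0.symm]
    rcases (hk b).eq_or_lt with h1 | h1
    · simp [← h1, klFun_zero]
    rw [klFun_apply, Real.negMulLog, Real.log_div h1.ne' h0.ne']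
    field_simp
    ring
  rw [← Finset.sum_add_distrib, Finset.sum_congr rfl fun b _ => h b, Finset.sum_add_distrib,
    Finset.sum_sub_distrib, hk1, he1]
  ring

/-- Relative entropy of two kernels to a finite alphabet, averaged over the source. -/
lemma klDiv_compProd_add_lintegral_negMulLog (ρ : Measure τ) [IsFiniteMeasure ρ]
    (κ η : Kernel τ β) [IsMarkovKernel κ] [IsMarkovKernel η]
    (hκη : ∀ᵐ t ∂ρ, ∀ b, η t {b} = 0 → κ t {b} = 0) :
    klDiv (ρ ⊗ₘ κ) (ρ ⊗ₘ η) + ∫⁻ t, ∑ b, ENNReal.ofReal (Real.negMulLog ((κ t).real {b})) ∂ρ =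
      ∫⁻ t, ∑ b, κ t {b} * ENNReal.ofReal (-Real.log ((η t).real {b})) ∂ρ := by
  have hmκ : ∀ b, Measurable fun t => κ t {b} := fun b =>
    Kernel.measurable_coe κ (measurableSet_singleton b)
  have hmη : ∀ b, Measurable fun t => η t {b} := fun b =>
    Kernel.measurable_coe η (measurableSet_singleton b)
  -- The quotient of the point masses is the density; atoms where the denominator vanishes are
  -- harmless by `hκη`.
  let g : τ × β → ℝ≥0∞ := fun x => κ x.1 {x.2} / η x.1 {x.2}
  have hg : Measurable g := measurable_from_prod_countable_left fun b => (hmκ b).div (hmη b)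
  have hden : ρ ⊗ₘ κ = (ρ ⊗ₘ η).withDensity g := by
    refine Measure.ext_of_lintegral _ fun f hf => ?_
    rw [lintegral_withDensity_eq_lintegral_mul _ hg hf, Measure.lintegral_compProd hf,
      Measure.lintegral_compProd (hg.mul hf)]
    refine lintegral_congr_ae ?_
    filter_upwards [hκη] with t ht
    rw [lintegral_fintype, lintegral_fintype]
    refine Finset.sum_congr rfl fun b _ => ?_
    simp only [g, Pi.mul_apply]
    by_cases h0 : η t {b} = 0
    · simp [h0, ht b h0]
    · rw [mul_right_comm, ENNReal.div_mul_cancel h0 (measure_ne_top _ _), mul_comm]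
  have hac : ρ ⊗ₘ κ ≪ ρ ⊗ₘ η := hden ▸ withDensity_absolutelyContinuous _ _
  have hrn : (ρ ⊗ₘ κ).rnDeriv (ρ ⊗ₘ η) =ᵐ[ρ ⊗ₘ η] g := by
    rw [hden]; exact Measure.rnDeriv_withDensity _ hg
  have hgm : Measurable fun x => ENNReal.ofReal (klFun (g x).toReal) :=
    (measurable_klFun.comp hg.ennreal_toReal).ennreal_ofReal
  rw [klDiv_eq_lintegral_klFun_of_ac hac,
    lintegral_congr_ae (g := fun x => ENNReal.ofReal (klFun (g x).toReal))
      (by filter_upwards [hrn] with x hx using by rw [hx]),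
    Measure.lintegral_compProd hgm, ← lintegral_add_left hgm.lintegral_kernel_prod_right']
  refine lintegral_congr_ae ?_
  filter_upwards [hκη] with t ht
  rw [lintegral_fintype]
  have hr : ∀ (ξ : Measure β) [IsProbabilityMeasure ξ], ∑ b, ξ.real {b} = 1 := by
    intro ξ _
    simp
  have hle : ∀ (ξ : Measure β) [IsProbabilityMeasure ξ] (b), ξ.real {b} ≤ 1 :=
    fun ξ _ b => measureReal_le_one
  have h := sum_klFun_div_add_sum_negMulLog (k := fun b => (κ t).real {b})
    (e := fun b => (η t).real {b}) (fun b => measureReal_nonneg) (hr _)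
    (fun b => measureReal_nonneg) (hr _) (fun b hb => by
      rw [measureReal_eq_zero_iff] at hb ⊢; exact ht b hb)
  have hkl : ∀ b, 0 ≤ klFun ((κ t).real {b} / (η t).real {b}) * (η t).real {b} := fun b =>
    mul_nonneg (klFun_nonneg (by positivity)) measureReal_nonneg
  have hnm : ∀ b, 0 ≤ Real.negMulLog ((κ t).real {b}) := fun b =>
    Real.negMulLog_nonneg measureReal_nonneg (hle _ b)
  have hlog : ∀ b, 0 ≤ -Real.log ((η t).real {b}) := fun b =>
    neg_nonneg.2 (Real.log_nonpos measureReal_nonneg (hle _ b))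
  calc ∑ b, ENNReal.ofReal (klFun (g (t, b)).toReal) * η t {b}
        + ∑ b, ENNReal.ofReal (Real.negMulLog ((κ t).real {b}))
      = ENNReal.ofReal (∑ b, klFun ((κ t).real {b} / (η t).real {b}) * (η t).real {b}
          + ∑ b, Real.negMulLog ((κ t).real {b})) := by
        rw [ENNReal.ofReal_add (Finset.sum_nonneg fun b _ => hkl b)
          (Finset.sum_nonneg fun b _ => hnm b), ENNReal.ofReal_sum_of_nonneg fun b _ => hkl b,
          ENNReal.ofReal_sum_of_nonneg fun b _ => hnm b]
        congr 1
        refine Finset.sum_congr rfl fun b _ => ?_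
        rw [ENNReal.ofReal_mul (klFun_nonneg (by positivity)), ofReal_measureReal]
        simp [g, Measure.real, ENNReal.toReal_div]
    _ = ∑ b, κ t {b} * ENNReal.ofReal (-Real.log ((η t).real {b})) := by
        rw [h, ENNReal.ofReal_sum_of_nonneg fun b _ => mul_nonneg measureReal_nonneg (hlog b)]
        refine Finset.sum_congr rfl fun b _ => ?_
        rw [ENNReal.ofReal_mul measureReal_nonneg, ofReal_measureReal]

variable {Ω α γ : Type*} [MeasurableSpace Ω] [MeasurableSpace α] [StandardBorelSpace α]
  [Nonempty α] [Nonempty β] [MeasurableSpace γ] {μ : Measure Ω} [IsFiniteMeasure μ]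

/-- Conditional entropy `H(B | C)` (in nats) of a finite-valued random variable. -/
def condEntropy (μ : Measure Ω) [IsFiniteMeasure μ] (B : Ω → β) (C : Ω → γ) : ℝ≥0∞ :=
  ∫⁻ c, ∑ b, ENNReal.ofReal (Real.negMulLog ((condDistrib B C μ c).real {b})) ∂(μ.map C)

/-- The cross-entropy against the law of B given C does not see A, by the tower property `htr`, so
it equals H(B | C). Written as a sum in [0, ∞] the identity needs no finiteness. -/
lemma condMutualInfo_add_condEntropy {A : Ω → α} {B : Ω → β} {C : Ω → γ} (hA : Measurable A)
    (hB : Measurable B) (hC : Measurable C) :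
    condMutualInfo μ A B C + condEntropy μ B (fun ω => (C ω, A ω)) = condEntropy μ B C := by
  let η := condDistrib B C μ
  have hmη : ∀ b, Measurable fun c => η c {b} := fun b =>
    Kernel.measurable_coe η (measurableSet_singleton b)
  have htr : ∀ {f : γ × β → ℝ≥0∞}, Measurable f →
      ∫⁻ x, ∑ b, condDistrib B (fun ω => (C ω, A ω)) μ x {b} * f (x.1, b)
        ∂(μ.map fun ω => (C ω, A ω)) = ∫⁻ c, ∑ b, η c {b} * f (c, b) ∂(μ.map C) := by
    intro f hf
    have h₁ : ∫⁻ x, f (x.1.1, x.2) ∂((μ.map fun ω => (C ω, A ω)) ⊗ₘ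
        condDistrib B (fun ω => (C ω, A ω)) μ) = ∫⁻ x, f x ∂(μ.map C ⊗ₘ η) := by
      rw [compProd_map_condDistrib hB.aemeasurable, compProd_map_condDistrib hB.aemeasurable,
        lintegral_map hf (by fun_prop), lintegral_map (by fun_prop) (by fun_prop)]
    rw [Measure.lintegral_compProd hf, Measure.lintegral_compProd (by fun_prop)] at h₁
    simp only [lintegral_fintype] at h₁
    simpa only [mul_comm] using h₁
  rw [condMutualInfo_eq_klDiv hA hB hC,
    ← compProd_map_condDistrib (X := fun ω => (C ω, A ω)) hB.aemeasurable, condEntropy,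
    klDiv_compProd_add_lintegral_negMulLog]
  · have hf : Measurable fun x : γ × β => ENNReal.ofReal (-Real.log ((η x.1).real {x.2})) :=
      measurable_from_prod_countable_left fun b =>
        (Real.measurable_log.comp (hmη b).ennreal_toReal).neg.ennreal_ofReal
    refine (htr hf).trans (lintegral_congr fun c => Finset.sum_congr rfl fun b _ => ?_)
    rw [Real.negMulLog, neg_mul_comm, ENNReal.ofReal_mul measureReal_nonneg, ofReal_measureReal]
  -- Absolute continuity: `htr` for the indicator of the null atoms of the law given C shows that
  -- the law given (C, A) almost surely does not charge them.
  · let f : γ × β → ℝ≥0∞ := fun x => Set.indicator {c | η c {x.2} = 0} 1 x.1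
    have hf : Measurable f := measurable_from_prod_countable_left fun b =>
      measurable_one.indicator (measurableSet_eq_fun (hmη b) measurable_const)
    have h := htr hf
    have h0 : ∀ c, ∑ b, η c {b} * f (c, b) = 0 := fun c => Finset.sum_eq_zero fun b _ => by
      by_cases hb : η c {b} = 0 <;> simp [f, hb]
    simp only [h0, lintegral_zero] at h
    rw [lintegral_eq_zero_iff (by
      refine Finset.measurable_sum _ fun b _ => ?_
      exact (Kernel.measurable_coe _ (measurableSet_singleton b)).mul (by fun_prop))] at h
    filter_upwards [h] with x hx b hb
    simp only [Pi.zero_apply, Finset.sum_eq_zero_iff, Finset.mem_univ, true_imp_iff] at hx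
    have hb' : η x.1 {b} = 0 := hb
    simpa [f, hb'] using hx b

/-- Conditional entropy from any version `q` of the conditional probabilities. -/
lemma condEntropy_eq_lintegral {B : Ω → β} {C : Ω → γ} (hB : Measurable B) (hC : Measurable C)
    (q : γ → β → ℝ≥0∞) (hq : ∀ b, Measurable fun c => q c b)
    (h : ∀ s, MeasurableSet s → ∀ b, μ (C ⁻¹' s ∩ B ⁻¹' {b}) = ∫⁻ ω in C ⁻¹' s, q (C ω) b ∂μ) :
    condEntropy μ B C =
      ∫⁻ ω, ∑ b, ENNReal.ofReal (Real.negMulLog (q (C ω) b).toReal) ∂μ := by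
  have hae : ∀ᵐ c ∂(μ.map C), ∀ b, condDistrib B C μ c {b} = q c b := by
    rw [ae_all_iff]
    intro b
    refine ae_eq_of_forall_setLIntegral_eq_of_sigmaFinite
      (Kernel.measurable_coe _ (measurableSet_singleton b)) (hq b) fun s hs _ => ?_
    rw [← Measure.compProd_apply_prod hs (measurableSet_singleton b),
      compProd_map_condDistrib hB.aemeasurable, Measure.map_apply (by fun_prop)
        (hs.prod (measurableSet_singleton b)), setLIntegral_map hs (hq b) hC, ← h s hs b]
    rfl
  rw [condEntropy, lintegral_congr_ae (g := fun c => ∑ b, ENNReal.ofReal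
    (Real.negMulLog (q c b).toReal)) (by
      filter_upwards [hae] with c hc
      simp only [Measure.real, hc]), lintegral_map (by fun_prop) hC]

end Entropy

/-! ### Secret sharing of posterior distributions

The parties `0, 1, 2, 3` stand for `U, V, W₁, W₂`. -/

section Sharing

variable {𝒳 : Type*} [Fintype 𝒳]

/-- For each set of parties, a distribution of the channel input: the posterior given what these
parties know. -/
abbrev Posteriors (𝒳 : Type*) [Fintype 𝒳] : Type _ := Finset (Fin 4) → stdSimplex ℝ 𝒳

/-- Independent uniform noise, one element of the circle for each party and each set of parties. -/
abbrev Noise : Type := Fin 4 → Finset (Fin 4) → UnitAddCircle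

/-- The uniform distribution of the noise. -/
abbrev noiseMeasure : Measure Noise :=
  Measure.pi fun _ => Measure.pi fun _ => AddCircle.haarAddCircle

instance : noiseMeasure.IsAddLeftInvariant :=
  haveI : ∀ _ : Fin 4, (Measure.pi fun _ : Finset (Fin 4) =>
      (AddCircle.haarAddCircle : Measure UnitAddCircle)).IsAddLeftInvariant :=
    fun _ => inferInstance
  Measure.pi.isAddLeftInvariant _

instance : StandardBorelSpace Noise :=
  haveI : ∀ _ : Fin 4, StandardBorelSpace (Finset (Fin 4) → UnitAddCircle) :=
    fun _ => inferInstance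
  StandardBorelSpace.pi_countable

/-- Erase the posteriors of the sets that are not contained in `A`. -/
def forget [Nonempty 𝒳] (A : Finset (Fin 4)) (κ : Posteriors 𝒳) : Posteriors 𝒳 :=
  fun S => if S ⊆ A then κ S else Classical.arbitrary _

/-- The posteriors are consistent: given the posteriors of all subsets of `A`, the input has the
distribution `κ A`. -/
def Coherent [Nonempty 𝒳] (P : Measure (Posteriors 𝒳)) : Prop :=
  ∀ (A : Finset (Fin 4)) (x : 𝒳) (f : Posteriors 𝒳 → ℝ≥0∞), Measurable f →
    ∫⁻ κ, ENNReal.ofReal (κ Finset.univ x) * f (forget A κ) ∂P =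
      ∫⁻ κ, ENNReal.ofReal (κ A x) * f (forget A κ) ∂P

lemma measurable_posterior_apply (A : Finset (Fin 4)) (x : 𝒳) :
    Measurable fun κ : Posteriors 𝒳 => (κ A : 𝒳 → ℝ) x :=
  (measurable_pi_apply x).comp (measurable_subtype_coe.comp (measurable_pi_apply A))

lemma measurable_forget [Nonempty 𝒳] (A : Finset (Fin 4)) : Measurable (forget (𝒳 := 𝒳) A) := by
  refine measurable_pi_lambda _ fun S => ?_
  by_cases h : S ⊆ A
  · simpa [forget, h] using measurable_pi_apply S
  · simp [forget, h]

/-- Secrets have to be encoded in a group with an invariant probability measure, so that they can be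
masked by uniform noise. The circle is such a group and is uncountable, hence large enough. -/
lemma exists_measurableEmbedding_circle (E : Type*) [MeasurableSpace E] [StandardBorelSpace E] :
    ∃ e : E → UnitAddCircle, MeasurableEmbedding e := by
  have h : ¬ Countable UnitAddCircle := by
    intro h
    have h' : Countable (Set.Ico (0 : ℝ) (0 + 1)) := (AddCircle.equivIco 1 0).symm.countable_iff.2 h
    have := Cardinal.mk_le_aleph0_iff.2 h'
    rw [Cardinal.mk_Ico_real (by norm_num)] at this
    exact absurd this (not_le.2 Cardinal.aleph0_lt_continuum)
  have hR : ¬ Countable ℝ := by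
    rw [not_countable_iff]; infer_instance
  exact ⟨_, (PolishSpace.measurableEquivOfNotCountable hR h).measurableEmbedding.comp
    (measurableEmbedding_embeddingReal E)⟩

variable (e : stdSimplex ℝ 𝒳 → UnitAddCircle)

/-- The party that completes the shares of the parties in `S`. -/
def leader (S : Finset (Fin 4)) : Fin 4 := if 2 ∈ S then 2 else 3

/-- The share of party `i` in the secret `κ S`: noise, except for the leader of `S`, whose share
makes the sum of all shares over `S` equal to `e (κ S)`. -/
def share (κ : Posteriors 𝒳) (k : Noise) (i : Fin 4) (S : Finset (Fin 4)) : UnitAddCircle :=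
  if i = leader S then e (κ S) - ∑ j ∈ S.erase i, k j S else k i S

/-- The shares that are known to the parties in `A`. -/
def shares (A : Finset (Fin 4)) (κ : Posteriors 𝒳) (k : Noise) : Noise :=
  fun i S => if i ∈ A ∧ i ∈ S then share e κ k i S else 0

/-- Recovery of the secret of `A`: the share of the leader cancels the noise of the others. If `A`
contains neither 2 nor 3, its leader is not a member and the secret is never handed out. -/
lemma sum_shares (A : Finset (Fin 4)) (hA : 2 ∈ A ∨ 3 ∈ A) (κ : Posteriors 𝒳) (k : Noise) :
    ∑ i ∈ A, shares e A κ k i A = e (κ A) := by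
  have hl : leader A ∈ A := by
    unfold leader; split_ifs with h
    · exact h
    · exact hA.resolve_left h
  rw [← Finset.add_sum_erase _ _ hl]
  have h : ∀ i ∈ A.erase (leader A), shares e A κ k i A = k i A := fun i hi => by
    simp [shares, share, (Finset.mem_erase.1 hi).1, (Finset.mem_erase.1 hi).2]
  rw [Finset.sum_congr rfl h]
  simp [shares, share, hl]

/-- A party of `S` outside `A`, if there is one. -/
def outsider (A S : Finset (Fin 4)) : Fin 4 := if h : (S \ A).Nonempty then (S \ A).min' h else 0

lemma outsider_mem {A S : Finset (Fin 4)} (h : ¬ S ⊆ A) : outsider A S ∈ S \ A := by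
  have h' : (S \ A).Nonempty := Finset.sdiff_nonempty.2 h
  rw [outsider, dif_pos h']
  exact Finset.min'_mem _ _

/-- The translation of the noise that hides from `A` the posteriors of the sets that are not
contained in `A`. -/
def shift [Nonempty 𝒳] (A : Finset (Fin 4)) (κ : Posteriors 𝒳) : Noise := fun j S =>
  if ¬ S ⊆ A ∧ j = outsider A S then e (κ S) - e (Classical.arbitrary _) else 0

/-- Secrecy. For S not contained in `A`, if the leader of S is a member of S in `A`, then
translating the noise of one outsider turns the secret into a default value; otherwise the shares
held by `A` are plain noise, which the translation leaves alone. -/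
lemma shares_shift_add [Nonempty 𝒳] (A : Finset (Fin 4)) (κ : Posteriors 𝒳) (k : Noise) :
    shares e A κ (shift e A κ + k) = shares e A (forget A κ) k := by
  funext i S
  unfold shares
  by_cases hi : i ∈ A ∧ i ∈ S
  swap
  · simp [hi]
  simp only [hi, and_self, if_true, share, Pi.add_apply]
  by_cases hS : S ⊆ A
  · simp [shift, forget, hS]
  have ho := Finset.mem_sdiff.1 (outsider_mem hS)
  have hne : outsider A S ≠ i := fun h => ho.2 (h ▸ hi.1)
  split_ifs with hl
  · rw [Finset.sum_add_distrib]
    have hsum : ∑ j ∈ S.erase i, shift e A κ j S = e (κ S) - e (Classical.arbitrary _) := by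
      rw [Finset.sum_eq_single_of_mem (outsider A S) (Finset.mem_erase.2 ⟨hne, ho.1⟩)]
      · simp [shift, hS]
      · intro j _ hj
        simp [shift, hj]
    rw [hsum]
    simp only [forget, hS, if_false]
    abel
  · simp [shift, hne.symm]

variable {e}

lemma measurable_share (he : Measurable e) (i : Fin 4) (S : Finset (Fin 4)) :
    Measurable fun z : Posteriors 𝒳 × Noise => share e z.1 z.2 i S := by
  unfold share
  split_ifs
  · have : Measurable fun z : Posteriors 𝒳 × Noise => e (z.1 S) :=
      he.comp ((measurable_pi_apply S).comp measurable_fst)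
    fun_prop
  · fun_prop

lemma measurable_shares (he : Measurable e) (A : Finset (Fin 4)) :
    Measurable fun z : Posteriors 𝒳 × Noise => shares e A z.1 z.2 := by
  refine measurable_pi_lambda _ fun i => measurable_pi_lambda _ fun S => ?_
  unfold shares
  split_ifs
  · exact measurable_share he i S
  · fun_prop

/-- Given the shares of the parties in `A`, the input has the distribution `κ A`. -/
lemma lintegral_mul_shares [Nonempty 𝒳] {P : Measure (Posteriors 𝒳)} [IsProbabilityMeasure P]
    (hP : Coherent P) (he : Measurable e) (A : Finset (Fin 4)) (x : 𝒳) {f : Noise → ℝ≥0∞}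
    (hf : Measurable f) :
    ∫⁻ z, ENNReal.ofReal (z.1 Finset.univ x) * f (shares e A z.1 z.2) ∂(P.prod noiseMeasure) =
      ∫⁻ z, ENNReal.ofReal (z.1 A x) * f (shares e A z.1 z.2) ∂(P.prod noiseMeasure) := by
  have hfs : Measurable fun z : Posteriors 𝒳 × Noise => f (shares e A z.1 z.2) :=
    hf.comp (measurable_shares he A)
  have hfs' : Measurable fun z : Posteriors 𝒳 × Noise => f (shares e A (forget A z.1) z.2) :=
    hfs.comp (((measurable_forget A).comp measurable_fst).prodMk measurable_snd)
  have key : ∀ S : Finset (Fin 4),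
      ∫⁻ z, ENNReal.ofReal (z.1 S x) * f (shares e A z.1 z.2) ∂(P.prod noiseMeasure) =
        ∫⁻ k, ∫⁻ κ, ENNReal.ofReal (κ S x) * f (shares e A (forget A κ) k) ∂P ∂noiseMeasure := by
    intro S
    have hx : Measurable fun z : Posteriors 𝒳 × Noise => ENNReal.ofReal (z.1 S x) :=
      ((measurable_posterior_apply S x).comp measurable_fst).ennreal_ofReal
    rw [lintegral_prod (fun z : Posteriors 𝒳 × Noise =>
        ENNReal.ofReal (z.1 S x) * f (shares e A z.1 z.2)) (hx.mul hfs).aemeasurable,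
      lintegral_lintegral_swap
        (f := fun k κ => ENNReal.ofReal ((κ : Posteriors 𝒳) S x) * f (shares e A (forget A κ) k))
        ((hx.mul hfs').comp measurable_swap).aemeasurable]
    refine lintegral_congr fun κ => ?_
    -- For fixed κ, Haar invariance permits a translation of the noise that depends on κ. The shares
    -- then depend on `forget A κ` only, and coherence applies for each fixed noise.
    rw [← lintegral_add_left_eq_self _ (shift e A κ)]
    simp only [shares_shift_add]
  rw [key, key]
  refine lintegral_congr fun k => ?_
  exact hP A x (fun κ => f (shares e A κ k)) (hfs.comp (measurable_id.prodMk measurable_const))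

lemma sum_ofReal_stdSimplex (π : stdSimplex ℝ 𝒳) : ∑ x, ENNReal.ofReal (π x) = 1 := by
  have h : ∀ x, 0 ≤ (π : 𝒳 → ℝ) x := π.2.1
  have h' : ∑ x, (π : 𝒳 → ℝ) x = 1 := π.2.2
  rw [← ENNReal.ofReal_one, ← h', ENNReal.ofReal_sum_of_nonneg fun x _ => h x]

end Sharing

/-! ### Auxiliary variables from posterior distributions -/

section OutputEntropy

variable {𝒳 𝒴 β : Type*} [Fintype 𝒳] [Fintype 𝒴] [Fintype β]

open Classical in
/-- Transition probabilities from the input to the function `f` of the output. -/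
def marginal (p : 𝒳 → PMF 𝒴) (f : 𝒴 → β) (x : 𝒳) (b : β) : ℝ :=
  ∑ y, if f y = b then (p x y).toReal else 0

lemma marginal_nonneg {𝒳 β : Type*} (p : 𝒳 → PMF 𝒴) (f : 𝒴 → β) (x : 𝒳) (b : β) : 0 ≤ marginal p f x b :=
  Finset.sum_nonneg fun _ _ => by split_ifs <;> simp

lemma sum_pmf_toReal (q : PMF 𝒴) : ∑ y, (q y).toReal = 1 := by
  rw [← ENNReal.toReal_sum fun y _ => q.apply_ne_top y, ← tsum_fintype (L := .unconditional _),
    q.tsum_coe, ENNReal.toReal_one]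

lemma sum_marginal {𝒳 : Type*} (p : 𝒳 → PMF 𝒴) (f : 𝒴 → β) (x : 𝒳) : ∑ b, marginal p f x b = 1 := by
  classical
  unfold marginal
  rw [Finset.sum_comm]
  simp [sum_pmf_toReal]

/-- Entropy of the output of the channel `w` when the input has distribution `π`. -/
def outEntropy (w : 𝒳 → β → ℝ) (π : 𝒳 → ℝ) : ℝ := ∑ b, Real.negMulLog (∑ x, π x * w x b)

lemma continuous_outEntropy (w : 𝒳 → β → ℝ) : Continuous (outEntropy w) := by
  unfold outEntropy
  exact continuous_finsetSum _ fun b _ => Real.continuous_negMulLog.comp (by fun_prop)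

lemma continuous_outEntropy_posterior (w : 𝒳 → β → ℝ) (A : Finset (Fin 4)) :
    Continuous fun κ : Posteriors 𝒳 => outEntropy w (κ A) :=
  (continuous_outEntropy w).comp (continuous_subtype_val.comp (continuous_apply A))

lemma sum_stdSimplex_mul_marginal_mem_Icc (p : 𝒳 → PMF 𝒴) (f : 𝒴 → β) (π : stdSimplex ℝ 𝒳)
    (b : β) : ∑ x, π x * marginal p f x b ∈ Set.Icc (0 : ℝ) 1 := by
  have h0 : ∀ x, 0 ≤ (π : 𝒳 → ℝ) x := π.2.1
  have h1 : ∑ x, (π : 𝒳 → ℝ) x = 1 := π.2.2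
  refine ⟨Finset.sum_nonneg fun x _ => mul_nonneg (h0 x) (marginal_nonneg p f x b), ?_⟩
  rw [← h1]
  refine Finset.sum_le_sum fun x _ => mul_le_of_le_one_right (h0 x) ?_
  rw [← sum_marginal p f x]
  exact Finset.single_le_sum (fun b _ => marginal_nonneg p f x b) (Finset.mem_univ b)

lemma outEntropy_nonneg (p : 𝒳 → PMF 𝒴) (f : 𝒴 → β) (π : stdSimplex ℝ 𝒳) :
    0 ≤ outEntropy (marginal p f) π :=
  Finset.sum_nonneg fun b _ => Real.negMulLog_nonneg
    (sum_stdSimplex_mul_marginal_mem_Icc p f π b).1 (sum_stdSimplex_mul_marginal_mem_Icc p f π b).2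

end OutputEntropy

/-! ### Joint law of posteriors, noise, channel input and output. -/

section Joint

variable {𝒳 𝒴 : Type*} [Fintype 𝒳] [MeasurableSpace 𝒳] [Fintype 𝒴] [MeasurableSpace 𝒴]

/-- `D` consists of posteriors with distribution `P` and of independent noise; given `D`, the input
`X` has the distribution given by the posterior of the set of all parties, and `Y` is the output of
the channel `p` with input `X`. -/
structure IsJoint (p : 𝒳 → PMF 𝒴) (P : Measure (Posteriors 𝒳)) {Ω : Type*} [MeasurableSpace Ω]
    (μ : Measure Ω) (D : Ω → Posteriors 𝒳 × Noise) (X : Ω → 𝒳) (Y : Ω → 𝒴) : Prop where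
  measurable_D : Measurable D
  measurable_X : Measurable X
  measurable_Y : Measurable Y
  lintegral_eq : ∀ F : Posteriors 𝒳 × Noise → 𝒳 → 𝒴 → ℝ≥0∞, (∀ x y, Measurable fun z => F z x y) →
    ∫⁻ ω, F (D ω) (X ω) (Y ω) ∂μ =
      ∑ x, ∑ y, p x y * ∫⁻ z, ENNReal.ofReal (z.1 Finset.univ x) * F z x y ∂(P.prod noiseMeasure)

/-- The outer region requires a sample space in `Type`, whereas the alphabets may live in any
universe. Posteriors and noise are therefore coded by a real number, the input-output pair by an
index in `Fin`. -/
lemma exists_isJoint [Nonempty 𝒳] [MeasurableSingletonClass 𝒳] [MeasurableSingletonClass 𝒴]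
    (p : 𝒳 → PMF 𝒴) (P : Measure (Posteriors 𝒳)) :
    ∃ (Ω : Type) (_ : MeasurableSpace Ω) (μ : Measure Ω) (D : Ω → Posteriors 𝒳 × Noise)
      (X : Ω → 𝒳) (Y : Ω → 𝒴), IsJoint p P μ D X Y := by
  let t : Fin (Fintype.card (𝒳 × 𝒴)) ≃ 𝒳 × 𝒴 := (Fintype.equivFin _).symm
  have hemb := measurableEmbedding_embeddingReal (Posteriors 𝒳 × Noise)
  let g : Fin (Fintype.card (𝒳 × 𝒴)) → Posteriors 𝒳 × Noise → ℝ≥0∞ := fun i z =>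
    p (t i).1 (t i).2 * ENNReal.ofReal (z.1 Finset.univ (t i).1)
  have hx : ∀ x, Measurable fun z : Posteriors 𝒳 × Noise => ENNReal.ofReal (z.1 Finset.univ x) := fun x =>
    ((measurable_posterior_apply Finset.univ x).comp measurable_fst).ennreal_ofReal
  have hg : ∀ i, Measurable (g i) := fun i => (hx _).const_mul _
  let μ : Measure (ℝ × Fin (Fintype.card (𝒳 × 𝒴))) :=
    ∑ i, ((P.prod noiseMeasure).withDensity (g i)).map fun z => (embeddingReal (Posteriors 𝒳 × Noise) z, i)
  refine ⟨ℝ × Fin (Fintype.card (𝒳 × 𝒴)), inferInstance, μ, fun ω => hemb.invFun ω.1,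
    fun ω => (t ω.2).1, fun ω => (t ω.2).2, hemb.measurable_invFun.comp measurable_fst,
    (measurable_of_finite fun i => (t i).1).comp measurable_snd,
    (measurable_of_finite fun i => (t i).2).comp measurable_snd, fun F hF => ?_⟩
  have hF' : Measurable fun ω : ℝ × Fin (Fintype.card (𝒳 × 𝒴)) =>
      F (hemb.invFun ω.1) (t ω.2).1 (t ω.2).2 :=
    measurable_from_prod_countable_left fun i =>
      (hF (t i).1 (t i).2).comp hemb.measurable_invFun
  rw [lintegral_finsetSum_measure]
  simp_rw [lintegral_map hF' (hemb.measurable.prodMk measurable_const)]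
  have h : ∀ i, ∫⁻ z, F (hemb.invFun (embeddingReal (Posteriors 𝒳 × Noise) z)) (t i).1 (t i).2
      ∂((P.prod noiseMeasure).withDensity (g i)) = p (t i).1 (t i).2 * ∫⁻ z,
        ENNReal.ofReal (z.1 Finset.univ (t i).1) * F z (t i).1 (t i).2 ∂(P.prod noiseMeasure) := by
    intro i
    simp_rw [hemb.leftInverse_invFun _]
    rw [lintegral_withDensity_eq_lintegral_mul _ (hg i) (hF _ _),
      ← lintegral_const_mul _ ((hx _).fun_mul (hF _ _))]
    refine lintegral_congr fun z => ?_
    simp only [g, Pi.mul_apply, mul_assoc]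
  simp_rw [h]
  rw [← Fintype.sum_prod_type' (f := fun x y => p x y * ∫⁻ z,
        ENNReal.ofReal (z.1 Finset.univ x) * F z x y ∂(P.prod noiseMeasure))]
  exact t.sum_comp fun xy => p xy.1 xy.2 * ∫⁻ z,
        ENNReal.ofReal (z.1 Finset.univ xy.1) * F z xy.1 xy.2 ∂(P.prod noiseMeasure)

variable {p : 𝒳 → PMF 𝒴} {P : Measure (Posteriors 𝒳)} {Ω : Type*} [MeasurableSpace Ω]
  {μ : Measure Ω} {D : Ω → Posteriors 𝒳 × Noise} {X : Ω → 𝒳} {Y : Ω → 𝒴}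

lemma IsJoint.lintegral_comp (h : IsJoint p P μ D X Y) {G : Posteriors 𝒳 × Noise → ℝ≥0∞}
    (hG : Measurable G) : ∫⁻ ω, G (D ω) ∂μ = ∫⁻ z, G z ∂(P.prod noiseMeasure) := by
  have hx : ∀ x, Measurable fun z : Posteriors 𝒳 × Noise =>
      ENNReal.ofReal (z.1 Finset.univ x) := fun x =>
    ((measurable_posterior_apply Finset.univ x).comp measurable_fst).ennreal_ofReal
  rw [h.lintegral_eq (fun z _ _ => G z) fun _ _ => hG]
  have h1 : ∀ x, ∑ y, p x y = 1 := fun x => by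
    rw [← tsum_fintype (L := .unconditional _), (p x).tsum_coe]
  simp_rw [← Finset.sum_mul, h1, one_mul]
  rw [← lintegral_finsetSum _ fun x _ => (hx x).fun_mul hG]
  simp_rw [← Finset.sum_mul, sum_ofReal_stdSimplex, one_mul]

lemma IsJoint.isProbabilityMeasure [IsProbabilityMeasure P] (h : IsJoint p P μ D X Y) :
    IsProbabilityMeasure μ :=
  ⟨by simpa using h.lintegral_comp (G := fun _ => 1) measurable_const⟩

end Joint

/-! ### Observations of the parties -/

section Observation

variable {𝒳 : Type*} [Fintype 𝒳] (e : stdSimplex ℝ 𝒳 → UnitAddCircle)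

/-- The shares of party `i` as a real number. -/
def party (i : Fin 4) (z : Posteriors 𝒳 × Noise) : ℝ :=
  embeddingReal (Finset (Fin 4) → UnitAddCircle) (shares e Finset.univ z.1 z.2 i)

/-- The variables of the parties in `A`. -/
def observed (A : Finset (Fin 4)) (z : Posteriors 𝒳 × Noise) : Fin 4 → ℝ :=
  fun i => if i ∈ A then party e i z else 0

/-- The variable `c` carries the same information as the variables of the parties in `A`. -/
def Observes {γ : Type*} [MeasurableSpace γ] (A : Finset (Fin 4))
    (c : Posteriors 𝒳 × Noise → γ) : Prop :=
  ∃ (φ : (Fin 4 → ℝ) → γ) (ψ : γ → Fin 4 → ℝ), Measurable φ ∧ Measurable ψ ∧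
    (∀ z, c z = φ (observed e A z)) ∧ ∀ z, ψ (c z) = observed e A z

lemma observes_party (i : Fin 4) : Observes e {i} (party e i) := by
  refine ⟨fun s => s i, fun r j => if j = i then r else 0, by fun_prop, ?_, ?_, ?_⟩
  · refine measurable_pi_lambda _ fun j => ?_
    split_ifs <;> fun_prop
  · simp [observed]
  · intro z
    funext j
    by_cases h : j = i
    · simp [observed, h]
    · simp [observed, h]

variable {e}

/-- Allows all the nested tuples in the conditions of the outer region to be treated alike: only the
set of parties counts. -/
lemma Observes.prodMk {γ δ : Type*} [MeasurableSpace γ] [MeasurableSpace δ]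
    {A B : Finset (Fin 4)} {c : Posteriors 𝒳 × Noise → γ} {d : Posteriors 𝒳 × Noise → δ}
    (hc : Observes e A c) (hd : Observes e B d) : Observes e (A ∪ B) fun z => (c z, d z) := by
  obtain ⟨φ, ψ, hφ, hψ, hcφ, hcψ⟩ := hc
  obtain ⟨φ', ψ', hφ', hψ', hdφ, hdψ⟩ := hd
  have hmask : ∀ S : Finset (Fin 4),
      Measurable fun (s : Fin 4 → ℝ) i => if i ∈ S then s i else 0 := fun S => by
    refine measurable_pi_lambda _ fun i => ?_
    split_ifs <;> fun_prop
  refine ⟨fun s => (φ fun i => if i ∈ A then s i else 0, φ' fun i => if i ∈ B then s i else 0),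
    fun x i => if i ∈ A then ψ x.1 i else ψ' x.2 i,
    (hφ.comp (hmask A)).prodMk (hφ'.comp (hmask B)), ?_, ?_, ?_⟩
  · refine measurable_pi_lambda _ fun i => ?_
    split_ifs <;> fun_prop
  · intro z
    refine Prod.ext ((hcφ z).trans (congrArg φ ?_)) ((hdφ z).trans (congrArg φ' ?_))
    · funext i
      by_cases h : i ∈ A <;> simp [observed, h]
    · funext i
      by_cases h : i ∈ B <;> simp [observed, h]
  · intro z
    funext i
    by_cases h : i ∈ A <;> simp [hcψ, hdψ, observed, h]

lemma measurable_party (he : Measurable e) (i : Fin 4) : Measurable (party e i) :=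
  (measurableEmbedding_embeddingReal _).measurable.comp
    ((measurable_pi_apply i).comp (measurable_shares he Finset.univ))

lemma measurable_observed (he : Measurable e) (A : Finset (Fin 4)) :
    Measurable (observed e A) := by
  refine measurable_pi_lambda _ fun i => ?_
  unfold observed
  split_ifs
  · exact measurable_party he i
  · fun_prop

lemma shares_eq_ite (A : Finset (Fin 4)) (z : Posteriors 𝒳 × Noise) (i : Fin 4) :
    shares e A z.1 z.2 i = if i ∈ A then shares e Finset.univ z.1 z.2 i else 0 := by
  funext S
  by_cases h : i ∈ A <;> simp [shares, h]

/-- What the parties in `A` observe is a function of their shares. -/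
lemma exists_observed_eq_comp_shares (A : Finset (Fin 4)) :
    ∃ φ : Noise → Fin 4 → ℝ, Measurable φ ∧
      ∀ z : Posteriors 𝒳 × Noise, observed e A z = φ (shares e A z.1 z.2) := by
  refine ⟨fun s i => if i ∈ A then embeddingReal _ (s i) else 0, ?_, fun z => ?_⟩
  · refine measurable_pi_lambda _ fun i => ?_
    split_ifs
    · exact (measurableEmbedding_embeddingReal _).measurable.comp (measurable_pi_apply i)
    · fun_prop
  · funext i
    by_cases h : i ∈ A
    · simp [observed, party, h, shares_eq_ite A]
    · simp [observed, h]

/-- The parties in `A` know the posterior `κ A`. -/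
lemma exists_decode [Nonempty 𝒳] (he : MeasurableEmbedding e) {A : Finset (Fin 4)}
    (hA : 2 ∈ A ∨ 3 ∈ A) : ∃ d : (Fin 4 → ℝ) → stdSimplex ℝ 𝒳, Measurable d ∧
      ∀ z : Posteriors 𝒳 × Noise, d (observed e A z) = z.1 A := by
  have hemb := measurableEmbedding_embeddingReal (Finset (Fin 4) → UnitAddCircle)
  refine ⟨fun s => he.invFun (∑ i ∈ A, hemb.invFun (s i) A), he.measurable_invFun.comp ?_,
    fun z => ?_⟩
  · refine Finset.measurable_fun_sum _ fun i _ => ?_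
    exact (measurable_pi_apply A).comp (hemb.measurable_invFun.comp (measurable_pi_apply i))
  · have h : ∀ i ∈ A, hemb.invFun (observed e A z i) A = shares e A z.1 z.2 i A := fun i hi => by
      simp only [observed, hi, if_true, party, hemb.leftInverse_invFun _]
      rw [shares_eq_ite A, if_pos hi]
    beta_reduce
    rw [Finset.sum_congr rfl h, sum_shares e A hA, he.leftInverse_invFun]

end Observation

/-! ### Output entropies given the observations of a coalition. -/

section ObservedEntropy

variable {𝒳 𝒴 β : Type*} [Fintype 𝒳] [Nonempty 𝒳] [MeasurableSpace 𝒳]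
  [Fintype 𝒴] [MeasurableSpace 𝒴] [MeasurableSingletonClass 𝒴]
  [Fintype β] [Nonempty β] [MeasurableSpace β] [MeasurableSingletonClass β]
  {γ : Type*} [MeasurableSpace γ]
  {p : 𝒳 → PMF 𝒴} {P : Measure (Posteriors 𝒳)} [IsProbabilityMeasure P]
  {Ω : Type*} [MeasurableSpace Ω] {μ : Measure Ω} [IsFiniteMeasure μ]
  {D : Ω → Posteriors 𝒳 × Noise} {X : Ω → 𝒳} {Y : Ω → 𝒴} {e : stdSimplex ℝ 𝒳 → UnitAddCircle}

/-- The entropy of a function of the output given the variables of the parties in `A`. -/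
lemma IsJoint.condEntropy_eq (h : IsJoint p P μ D X Y) (hP : Coherent P)
    (he : MeasurableEmbedding e) {A : Finset (Fin 4)} (hA : 2 ∈ A ∨ 3 ∈ A)
    {c : Posteriors 𝒳 × Noise → γ} (hc : Observes e A c) (f : 𝒴 → β) :
    condEntropy μ (fun ω => f (Y ω)) (fun ω => c (D ω)) =
      ENNReal.ofReal (∫ κ, outEntropy (marginal p f) (κ A) ∂P) := by
  classical
  obtain ⟨φ, ψ, hφ, hψ, hcφ, hcψ⟩ := hc
  obtain ⟨d, hd, hdA⟩ := exists_decode he hA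
  obtain ⟨φ', hφ', hφA⟩ := exists_observed_eq_comp_shares (e := e) A
  have hcm : Measurable c := by
    rw [funext hcφ]; exact hφ.comp (measurable_observed he.measurable A)
  have hdψ : ∀ z, d (ψ (c z)) = z.1 A := fun z => by rw [hcψ, hdA]
  have hx : ∀ S x, Measurable fun z : Posteriors 𝒳 × Noise => ENNReal.ofReal (z.1 S x) :=
    fun S x => ((measurable_posterior_apply S x).comp measurable_fst).ennreal_ofReal
  -- The output law when the input has law κ A. It is a function of the observation because the
  -- coalition can decode κ A.
  let q : γ → β → ℝ≥0∞ := fun c b => ENNReal.ofReal (∑ x, d (ψ c) x * marginal p f x b)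
  have hq : ∀ b, Measurable fun c => q c b := fun b => by
    refine (Finset.measurable_fun_sum _ fun x _ => Measurable.mul_const ?_ _).ennreal_ofReal
    exact (measurable_pi_apply x).comp (measurable_subtype_coe.comp (hd.comp hψ))
  have hqc : ∀ z b, q (c z) b = ∑ x, ENNReal.ofReal (z.1 A x) *
      ENNReal.ofReal (marginal p f x b) := fun z b => by
    have h0 : ∀ x, 0 ≤ (z.1 A : 𝒳 → ℝ) x := (z.1 A).2.1
    simp only [q, hdψ]
    rw [ENNReal.ofReal_sum_of_nonneg fun x _ => mul_nonneg (h0 x) (marginal_nonneg p f x b)]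
    exact Finset.sum_congr rfl fun x _ => ENNReal.ofReal_mul (h0 x)
  have hfY : Measurable fun ω => f (Y ω) := (measurable_of_finite f).comp h.measurable_Y
  have hcD : Measurable fun ω => c (D ω) := hcm.comp h.measurable_D
  rw [condEntropy_eq_lintegral hfY hcD q hq]
  · have hG : Measurable fun z : Posteriors 𝒳 × Noise =>
        ∑ b, ENNReal.ofReal (Real.negMulLog (q (c z) b).toReal) := by
      have : ∀ b, Measurable fun z => q (c z) b := fun b => (hq b).comp hcm
      fun_prop
    rw [h.lintegral_comp hG]
    have hpt : ∀ z : Posteriors 𝒳 × Noise,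
        ∑ b, ENNReal.ofReal (Real.negMulLog (q (c z) b).toReal) =
          ENNReal.ofReal (outEntropy (marginal p f) (z.1 A)) := fun z => by
      rw [outEntropy, ENNReal.ofReal_sum_of_nonneg]
      · refine Finset.sum_congr rfl fun b _ => ?_
        simp only [q, hdψ]
        rw [ENNReal.toReal_ofReal (sum_stdSimplex_mul_marginal_mem_Icc p f (z.1 A) b).1]
      · exact fun b _ => Real.negMulLog_nonneg (sum_stdSimplex_mul_marginal_mem_Icc p f _ b).1
          (sum_stdSimplex_mul_marginal_mem_Icc p f _ b).2
    simp_rw [hpt]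
    have hcont := continuous_outEntropy_posterior (marginal p f) A
    rw [lintegral_prod (fun z : Posteriors 𝒳 × Noise =>
        ENNReal.ofReal (outEntropy (marginal p f) (z.1 A)))
        (hcont.measurable.comp measurable_fst).ennreal_ofReal.aemeasurable,
      ofReal_integral_eq_lintegral_ofReal
        (hcont.integrable_of_hasCompactSupport (HasCompactSupport.of_compactSpace _))
        (ae_of_all _ fun κ => outEntropy_nonneg p f (κ A))]
    simp
  · intro s hs b
    let I : Posteriors 𝒳 × Noise → ℝ≥0∞ := fun z => s.indicator 1 (c z)
    have hI : Measurable I := (measurable_one.indicator hs).comp hcm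
    have hB : MeasurableSet ((fun ω => f (Y ω)) ⁻¹' {b}) := hfY (measurableSet_singleton b)
    have hL : μ ((fun ω => c (D ω)) ⁻¹' s ∩ (fun ω => f (Y ω)) ⁻¹' {b}) =
        ∫⁻ ω, I (D ω) * (if f (Y ω) = b then 1 else 0) ∂μ := by
      rw [← lintegral_indicator_one ((hcD hs).inter hB)]
      refine lintegral_congr fun ω => ?_
      by_cases h₁ : c (D ω) ∈ s <;> by_cases h₂ : f (Y ω) = b <;> simp [I, h₁, h₂]
    have hR : ∫⁻ ω in (fun ω => c (D ω)) ⁻¹' s, q (c (D ω)) b ∂μ =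
        ∫⁻ ω, I (D ω) * q (c (D ω)) b ∂μ := by
      rw [← lintegral_indicator (hcD hs)]
      refine lintegral_congr fun ω => ?_
      by_cases h₁ : c (D ω) ∈ s <;> simp [I, h₁]
    rw [hL, hR, h.lintegral_eq (fun z _ y => I z * (if f y = b then 1 else 0))
      (fun x y => hI.mul_const _), 
      h.lintegral_comp (G := fun z => I z * q (c z) b) (hI.mul ((hq b).comp hcm))]
    simp_rw [hqc, Finset.mul_sum]
    rw [lintegral_finsetSum _ fun x _ => hI.fun_mul ((hx A x).mul_const _)]
    refine Finset.sum_congr rfl fun x _ => ?_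
    -- The use of secrecy and coherence: on events observed by the coalition, the posterior of all
    -- parties may be replaced by κ A.
    have hsec : ∫⁻ z, ENNReal.ofReal (z.1 Finset.univ x) * I z ∂(P.prod noiseMeasure) =
        ∫⁻ z, ENNReal.ofReal (z.1 A x) * I z ∂(P.prod noiseMeasure) := by
      have := lintegral_mul_shares hP he.measurable A x (f := fun n => s.indicator 1 (φ (φ' n)))
        ((measurable_one.indicator hs).comp (hφ.comp hφ'))
      simpa only [I, hcφ, hφA] using this
    have hmar : ENNReal.ofReal (marginal p f x b) = ∑ y, p x y * (if f y = b then 1 else 0) := by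
      rw [marginal, ENNReal.ofReal_sum_of_nonneg fun y _ => by split_ifs <;> simp]
      refine Finset.sum_congr rfl fun y _ => ?_
      split_ifs <;> simp [(p x).apply_ne_top y]
    calc ∑ y, p x y * ∫⁻ z, ENNReal.ofReal (z.1 Finset.univ x) *
            (I z * (if f y = b then 1 else 0)) ∂(P.prod noiseMeasure)
        = ∑ y, p x y * (if f y = b then 1 else 0) *
            ∫⁻ z, ENNReal.ofReal (z.1 A x) * I z ∂(P.prod noiseMeasure) := by
          refine Finset.sum_congr rfl fun y _ => ?_
          rw [← hsec, mul_assoc, ← lintegral_const_mul _ ((hx _ x).fun_mul hI)]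
          congr 1
          refine lintegral_congr fun z => ?_
          ring
      _ = ENNReal.ofReal (marginal p f x b) *
            ∫⁻ z, ENNReal.ofReal (z.1 A x) * I z ∂(P.prod noiseMeasure) := by
          rw [hmar, Finset.sum_mul]
      _ = _ := by
          rw [← lintegral_const_mul _ ((hx _ x).fun_mul hI)]
          refine lintegral_congr fun z => ?_
          ring

end ObservedEntropy

/-! ### Points of the outer region from coherent posteriors -/

section Chain

variable {Ω α β γ₁ γ₂ : Type*} [MeasurableSpace Ω]
  [MeasurableSpace α] [StandardBorelSpace α] [Nonempty α]
  [MeasurableSpace β] [StandardBorelSpace β] [Nonempty β]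
  [MeasurableSpace γ₁] [MeasurableSpace γ₂] {μ : Measure Ω} [IsFiniteMeasure μ]
  {U : Ω → α} {V : Ω → β} {W₁ : Ω → γ₁} {W₂ : Ω → γ₂}

lemma condMutualInfo_chain_triple {ε : Type*} [MeasurableSpace ε] [StandardBorelSpace ε]
    [Nonempty ε] {Y : Ω → ε} (hU : Measurable U) (hV : Measurable V) (hW₁ : Measurable W₁)
    (hW₂ : Measurable W₂) (hY : Measurable Y) :
    condMutualInfo μ U Y (fun ω => (W₁ ω, W₂ ω)) +
        condMutualInfo μ U V (fun ω => (W₁ ω, W₂ ω, Y ω)) =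
      condMutualInfo μ U V (fun ω => (W₁ ω, W₂ ω)) +
        condMutualInfo μ U Y (fun ω => (V ω, W₁ ω, W₂ ω)) := by
  have h := condMutualInfo_chain (μ := μ) (C := fun ω => (W₁ ω, W₂ ω)) hU hV (hW₁.prodMk hW₂) hY
  rw [← condMutualInfo_congr_cond (μ := μ) (C := fun ω => ((W₁ ω, W₂ ω), Y ω)) hU hV
      ((hW₁.prodMk hW₂).prodMk hY) MeasurableEquiv.prodAssoc,
    ← condMutualInfo_congr_cond (μ := μ) (C := fun ω => ((W₁ ω, W₂ ω), V ω)) hU hY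
      ((hW₁.prodMk hW₂).prodMk hV) MeasurableEquiv.prodComm] at h
  exact h

/-- The equality of `I(U; V | W₁, W₂, Y₁)` and `I(U; V | W₁, W₂, Y₂)` from its difference form. -/
lemma condMutualInfo_eq_of_diff {ε₁ ε₂ : Type*} [MeasurableSpace ε₁] [StandardBorelSpace ε₁]
    [Nonempty ε₁] [MeasurableSpace ε₂] [StandardBorelSpace ε₂] [Nonempty ε₂] {Y₁ : Ω → ε₁}
    {Y₂ : Ω → ε₂} (hU : Measurable U) (hV : Measurable V) (hW₁ : Measurable W₁)
    (hW₂ : Measurable W₂) (hY₁ : Measurable Y₁) (hY₂ : Measurable Y₂)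
    (h₁ : condMutualInfo μ U Y₁ (fun ω => (W₁ ω, W₂ ω)) ≠ ∞)
    (h₂ : condMutualInfo μ U Y₂ (fun ω => (W₁ ω, W₂ ω)) ≠ ∞)
    (hdiff : condMutualInfo μ U Y₁ (fun ω => (V ω, W₁ ω, W₂ ω)) +
        condMutualInfo μ U Y₂ (fun ω => (W₁ ω, W₂ ω)) =
      condMutualInfo μ U Y₂ (fun ω => (V ω, W₁ ω, W₂ ω)) +
        condMutualInfo μ U Y₁ (fun ω => (W₁ ω, W₂ ω))) :
    condMutualInfo μ U V (fun ω => (W₁ ω, W₂ ω, Y₁ ω)) =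
      condMutualInfo μ U V (fun ω => (W₁ ω, W₂ ω, Y₂ ω)) := by
  have c₁ := condMutualInfo_chain_triple (μ := μ) hU hV hW₁ hW₂ hY₁
  have c₂ := condMutualInfo_chain_triple (μ := μ) hU hV hW₁ hW₂ hY₂
  -- Only the finite I(U; Yᵢ | W₁, W₂) are cancelled; I(U; V | W₁, W₂), possibly infinite, stays as
  -- a summand of both sides.
  refine (ENNReal.add_right_inj (ENNReal.add_ne_top.2 ⟨h₂, h₁⟩)).1 ?_
  rw [add_assoc, c₁, add_comm (condMutualInfo μ U Y₂ _) (condMutualInfo μ U Y₁ _), add_assoc, c₂,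
    add_left_comm, add_left_comm (condMutualInfo μ U Y₁ _), add_comm (condMutualInfo μ U Y₂ _),
    hdiff, add_comm (condMutualInfo μ U Y₂ _)]

end Chain

/-! ### Informations, independence and Markov property of the parties' variables. -/

section Admissible

variable {𝒳 𝒴 β : Type*} [Fintype 𝒳] [MeasurableSpace 𝒳] [Fintype 𝒴] [MeasurableSpace 𝒴]
  {p : 𝒳 → PMF 𝒴} {P : Measure (Posteriors 𝒳)} [IsProbabilityMeasure P]
  {Ω : Type*} [MeasurableSpace Ω] {μ : Measure Ω}
  {D : Ω → Posteriors 𝒳 × Noise} {X : Ω → 𝒳} {Y : Ω → 𝒴} {e : stdSimplex ℝ 𝒳 → UnitAddCircle}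

/-- The inequality of entropies is kept alongside because `ENNReal.ofReal` truncates: it allows such
differences to be added. -/
lemma IsJoint.condMutualInfo_eq [Nonempty 𝒳] [MeasurableSingletonClass 𝒴] [IsFiniteMeasure μ]
    [Fintype β] [Nonempty β] [MeasurableSpace β]
    [MeasurableSingletonClass β] {γ : Type*} [MeasurableSpace γ] (h : IsJoint p P μ D X Y)
    (hP : Coherent P) (he : MeasurableEmbedding e) {A : Finset (Fin 4)} (hA : 2 ∈ A ∨ 3 ∈ A)
    {c : Posteriors 𝒳 × Noise → γ} (hc : Observes e A c) (i : Fin 4) (f : 𝒴 → β) :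
    condMutualInfo μ (fun ω => party e i (D ω)) (fun ω => f (Y ω)) (fun ω => c (D ω)) =
      ENNReal.ofReal (∫ κ, outEntropy (marginal p f) (κ A) ∂P -
        ∫ κ, outEntropy (marginal p f) (κ (A ∪ {i})) ∂P) ∧
    ∫ κ, outEntropy (marginal p f) (κ (A ∪ {i})) ∂P ≤
      ∫ κ, outEntropy (marginal p f) (κ A) ∂P := by
  have hcm : Measurable c := by
    obtain ⟨φ, -, hφ, -, hcφ, -⟩ := hc
    rw [funext hcφ]; exact hφ.comp (measurable_observed he.measurable A)
  have hadd := condMutualInfo_add_condEntropy (μ := μ)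
    ((measurable_party he.measurable i).comp h.measurable_D)
    ((measurable_of_finite f).comp h.measurable_Y) (hcm.comp h.measurable_D)
  have hnn : ∀ S : Finset (Fin 4), 0 ≤ ∫ κ, outEntropy (marginal p f) (κ S) ∂P := fun S =>
    integral_nonneg fun κ => outEntropy_nonneg p f (κ S)
  have h₁ := h.condEntropy_eq hP he (A := A ∪ {i})
    (by simp only [Finset.mem_union]; exact hA.imp Or.inl Or.inl) (hc.prodMk (observes_party e i)) f
  have h₂ := h.condEntropy_eq hP he hA hc f
  simp only [Function.comp_def] at hadd
  rw [h₁, h₂] at hadd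
  refine ⟨?_, ?_⟩
  · rw [ENNReal.ofReal_sub _ (hnn _)]
    exact ENNReal.eq_sub_of_add_eq ENNReal.ofReal_ne_top hadd
  · rw [← ENNReal.ofReal_le_ofReal_iff (hnn _), ← hadd]
    exact le_add_self

/-- Parties 0 and 1 never lead, so only their own noise enters their variables. This makes U and V
independent whatever the law of the posteriors. -/
lemma party_eq_of_ne_leader {𝒳 : Type*} [Fintype 𝒳] {e : stdSimplex ℝ 𝒳 → UnitAddCircle}
    {i : Fin 4} (hi : i = 0 ∨ i = 1) (z : Posteriors 𝒳 × Noise) :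
    party e i z = embeddingReal (Finset (Fin 4) → UnitAddCircle)
      (fun S => if i ∈ S then z.2 i S else 0) := by
  unfold party
  congr 1
  funext S
  have hl : i ≠ leader S := by
    unfold leader
    rcases hi with rfl | rfl <;> split_ifs <;> decide
  simp [shares, share, hl]

/-- The variables of the parties `0` and `1` are independent. -/
lemma IsJoint.indepFun_party (h : IsJoint p P μ D X Y) :
    IndepFun (fun ω => party e 0 (D ω)) (fun ω => party e 1 (D ω)) μ := by
  let g : Fin 4 → (Finset (Fin 4) → UnitAddCircle) → ℝ := fun i s =>
    embeddingReal (Finset (Fin 4) → UnitAddCircle) fun S => if i ∈ S then s S else 0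
  have hg : ∀ i, Measurable (g i) := fun i => by
    refine (measurableEmbedding_embeddingReal _).measurable.comp
      (measurable_pi_lambda _ fun S => ?_)
    split_ifs <;> fun_prop
  have hDm : Measurable fun ω => (D ω).2 := measurable_snd.comp h.measurable_D
  have hN : μ.map (fun ω => (D ω).2) = noiseMeasure := by
    refine Measure.ext_of_lintegral _ fun f hf => ?_
    rw [lintegral_map hf hDm,
      h.lintegral_comp (G := fun z => f z.2) (hf.comp measurable_snd),
      lintegral_prod (fun z : Posteriors 𝒳 × Noise => f z.2)
        (hf.comp measurable_snd).aemeasurable]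
    simp
  have hind : IndepFun (fun k : Noise => g 0 (k 0)) (fun k => g 1 (k 1)) noiseMeasure :=
    (iIndepFun_pi (μ := fun _ : Fin 4 => Measure.pi fun _ : Finset (Fin 4) =>
      (AddCircle.haarAddCircle : Measure UnitAddCircle)) (X := g)
      fun i => (hg i).aemeasurable).indepFun (by decide)
  have hm : ∀ i, Measurable fun k : Noise => g i (k i) := fun i =>
    (hg i).comp (measurable_pi_apply i)
  rw [indepFun_iff_measure_inter_preimage_eq_mul] at hind ⊢
  intro s t hs ht
  have h₀ : (fun ω => party e 0 (D ω)) = (fun k : Noise => g 0 (k 0)) ∘ fun ω => (D ω).2 := by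
    funext ω; exact party_eq_of_ne_leader (Or.inl rfl) (D ω)
  have h₁ : (fun ω => party e 1 (D ω)) = (fun k : Noise => g 1 (k 1)) ∘ fun ω => (D ω).2 := by
    funext ω; exact party_eq_of_ne_leader (Or.inr rfl) (D ω)
  have hst := hind s t hs ht
  rw [← hN, Measure.map_apply hDm ((hm 0 hs).inter (hm 1 ht)), Measure.map_apply hDm (hm 0 hs),
    Measure.map_apply hDm (hm 1 ht)] at hst
  rw [h₀, h₁]
  exact hst

lemma IsJoint.markov [MeasurableSingletonClass 𝒳] [MeasurableSingletonClass 𝒴]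
    (h : IsJoint p P μ D X Y) {G : Type*}
    [MeasurableSpace G] {g : Posteriors 𝒳 × Noise → G} (hg : Measurable g) {B : Set G}
    (hB : MeasurableSet B) (x : 𝒳) (y : 𝒴) :
    μ {ω | g (D ω) ∈ B ∧ X ω = x ∧ Y ω = y} = μ {ω | g (D ω) ∈ B ∧ X ω = x} * p x y := by
  classical
  let I : Posteriors 𝒳 × Noise → ℝ≥0∞ := fun z => B.indicator 1 (g z)
  have hI : Measurable I := (measurable_one.indicator hB).comp hg
  have hm : MeasurableSet {ω | g (D ω) ∈ B} := (hg.comp h.measurable_D) hB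
  have hmx : MeasurableSet {ω | X ω = x} := h.measurable_X (measurableSet_singleton x)
  have hmy : MeasurableSet {ω | Y ω = y} := h.measurable_Y (measurableSet_singleton y)
  have h1 : ∑ y, p x y = 1 := by
    rw [← tsum_fintype (L := .unconditional _), (p x).tsum_coe]
  have hL : μ {ω | g (D ω) ∈ B ∧ X ω = x ∧ Y ω = y} =
      ∫⁻ ω, I (D ω) * (if X ω = x ∧ Y ω = y then 1 else 0) ∂μ := by
    refine (lintegral_indicator_one (hm.inter (hmx.inter hmy))).symm.trans
      (lintegral_congr fun ω => ?_)
    by_cases h₁ : g (D ω) ∈ B <;> by_cases h₂ : X ω = x <;> by_cases h₃ : Y ω = y <;>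
      simp [I, h₁, h₂, h₃]
  have hR : μ {ω | g (D ω) ∈ B ∧ X ω = x} = ∫⁻ ω, I (D ω) * (if X ω = x then 1 else 0) ∂μ := by
    refine (lintegral_indicator_one (hm.inter hmx)).symm.trans (lintegral_congr fun ω => ?_)
    by_cases h₁ : g (D ω) ∈ B <;> by_cases h₂ : X ω = x <;> simp [I, h₁, h₂]
  rw [hL, hR, h.lintegral_eq (fun z x' y' => I z * (if x' = x ∧ y' = y then 1 else 0))
      (fun _ _ => hI.mul_const _), h.lintegral_eq (fun z x' _ => I z * (if x' = x then 1 else 0))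
      (fun _ _ => hI.mul_const _)]
  rw [Finset.sum_eq_single_of_mem x (Finset.mem_univ x) fun x' _ hx' => by simp [hx'],
    Finset.sum_eq_single_of_mem y (Finset.mem_univ y) fun y' _ hy' => by simp [hy'],
    Finset.sum_eq_single_of_mem x (Finset.mem_univ x) fun x' _ hx' => by simp [hx']]
  simp only [and_self, if_true, mul_one]
  rw [← Finset.sum_mul, h1, one_mul, mul_comm]

end Admissible

/-- The conditions on coherent posteriors under which they yield a point of the outer region. -/
theorem mem_outerRegion_of_coherent {𝒳 𝒴₁ 𝒴₂ : Type*}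
    [Fintype 𝒳] [Nonempty 𝒳] [MeasurableSpace 𝒳] [MeasurableSingletonClass 𝒳]
    [Fintype 𝒴₁] [Nonempty 𝒴₁] [MeasurableSpace 𝒴₁] [MeasurableSingletonClass 𝒴₁]
    [Fintype 𝒴₂] [Nonempty 𝒴₂] [MeasurableSpace 𝒴₂] [MeasurableSingletonClass 𝒴₂]
    {p : 𝒳 → PMF (𝒴₁ × 𝒴₂)} {P : Measure (Posteriors 𝒳)} [IsProbabilityMeasure P]
    (hP : Coherent P) {H₁ H₂ : Finset (Fin 4) → ℝ}
    (hH₁ : ∀ S, H₁ S = ∫ κ, outEntropy (marginal p Prod.fst) (κ S) ∂P)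
    (hH₂ : ∀ S, H₂ S = ∫ κ, outEntropy (marginal p Prod.snd) (κ S) ∂P)
    (hsum : ∀ J ⊆ {0, 1}, H₁ (J ∪ {2}) - H₁ (J ∪ {2, 3}) = H₂ (J ∪ {3}) - H₂ (J ∪ {2, 3}))
    (hU : H₁ {2} - H₁ {0, 2} = H₁ {1, 2} - H₁ {0, 1, 2})
    (hV : H₂ {3} - H₂ {1, 3} = H₂ {0, 3} - H₂ {0, 1, 3})
    {R : ℝ × ℝ} (hR₁ : R.1 ≤ H₁ {2} - H₁ {0, 2}) (hR₂ : R.2 ≤ H₂ {3} - H₂ {1, 3}) :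
    R ∈ outerRegion p := by
  obtain ⟨e, he⟩ := exists_measurableEmbedding_circle (stdSimplex ℝ 𝒳)
  obtain ⟨Ω, mΩ, μ, D, X, Y, h⟩ := exists_isJoint p P
  have := h.isProbabilityMeasure
  have hm : ∀ i, Measurable fun ω => party e i (D ω) := fun i =>
    (measurable_party he.measurable i).comp h.measurable_D
  have hY₁ : Measurable fun ω => (Y ω).1 := measurable_fst.comp h.measurable_Y
  have hY₂ : Measurable fun ω => (Y ω).2 := measurable_snd.comp h.measurable_Y
  have o := observes_party e
  -- conditional informations about the two outputs
  have info₁ : ∀ {γ : Type} [MeasurableSpace γ] {A B : Finset (Fin 4)} (_ : 2 ∈ A ∨ 3 ∈ A)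
      {c : Posteriors 𝒳 × Noise → γ} (_ : Observes e A c) (i : Fin 4) (_ : A ∪ {i} = B),
      condMutualInfo μ (fun ω => party e i (D ω)) (fun ω => (Y ω).1) (fun ω => c (D ω)) =
        ENNReal.ofReal (H₁ A - H₁ B) ∧ H₁ B ≤ H₁ A := by
    intro γ _ A B hA c hc i hB
    subst hB
    rw [hH₁, hH₁]
    exact h.condMutualInfo_eq hP he hA hc i Prod.fst
  have info₂ : ∀ {γ : Type} [MeasurableSpace γ] {A B : Finset (Fin 4)} (_ : 2 ∈ A ∨ 3 ∈ A)
      {c : Posteriors 𝒳 × Noise → γ} (_ : Observes e A c) (i : Fin 4) (_ : A ∪ {i} = B),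
      condMutualInfo μ (fun ω => party e i (D ω)) (fun ω => (Y ω).2) (fun ω => c (D ω)) =
        ENNReal.ofReal (H₂ A - H₂ B) ∧ H₂ B ≤ H₂ A := by
    intro γ _ A B hA c hc i hB
    subst hB
    rw [hH₂, hH₂]
    exact h.condMutualInfo_eq hP he hA hc i Prod.snd
  have s₀ : H₁ {2} - H₁ {2, 3} = H₂ {3} - H₂ {2, 3} := hsum ∅ (by decide)
  have s₁ : H₁ {0, 2} - H₁ {0, 2, 3} = H₂ {0, 3} - H₂ {0, 2, 3} := hsum {0} (by decide)
  have s₂ : H₁ {1, 2} - H₁ {1, 2, 3} = H₂ {1, 3} - H₂ {1, 2, 3} := hsum {1} (by decide)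
  have s₃ : H₁ {0, 1, 2} - H₁ {0, 1, 2, 3} = H₂ {0, 1, 3} - H₂ {0, 1, 2, 3} :=
    hsum {0, 1} (by decide)
  have o12 := (o 1).prodMk (o 2)
  have o02 := (o 0).prodMk (o 2)
  have o03 := (o 0).prodMk (o 3)
  have o13 := (o 1).prodMk (o 3)
  have o23 := (o 2).prodMk (o 3)
  have e₁ := (info₁ (by decide) (o 2) 0 (B := {0, 2}) (by decide)).1
  have e₂ := (info₂ (by decide) (o 3) 1 (B := {1, 3}) (by decide)).1
  have d₁ := info₁ (by decide) ((o 1).prodMk o23) 0 (B := {0, 1, 2, 3}) (by decide)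
  have d₂ := info₂ (by decide) ((o 1).prodMk o23) 0 (B := {0, 1, 2, 3}) (by decide)
  have d₃ := info₁ (by decide) o23 0 (B := {0, 2, 3}) (by decide)
  have d₄ := info₂ (by decide) o23 0 (B := {0, 2, 3}) (by decide)
  have hdiff : condMutualInfo μ (fun ω => party e 0 (D ω)) (fun ω => (Y ω).1)
        (fun ω => (party e 1 (D ω), party e 2 (D ω), party e 3 (D ω))) +
      condMutualInfo μ (fun ω => party e 0 (D ω)) (fun ω => (Y ω).2)
        (fun ω => (party e 2 (D ω), party e 3 (D ω))) =
      condMutualInfo μ (fun ω => party e 0 (D ω)) (fun ω => (Y ω).2)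
        (fun ω => (party e 1 (D ω), party e 2 (D ω), party e 3 (D ω))) +
      condMutualInfo μ (fun ω => party e 0 (D ω)) (fun ω => (Y ω).1)
        (fun ω => (party e 2 (D ω), party e 3 (D ω))) := by
    rw [d₁.1, d₂.1, d₃.1, d₄.1, ← ENNReal.ofReal_add (sub_nonneg.2 d₁.2) (sub_nonneg.2 d₄.2),
      ← ENNReal.ofReal_add (sub_nonneg.2 d₂.2) (sub_nonneg.2 d₃.2)]
    congr 1
    rw [show ({1} ∪ ({2} ∪ {3}) : Finset (Fin 4)) = {1, 2, 3} by decide,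
      show ({2} ∪ {3} : Finset (Fin 4)) = {2, 3} by decide]
    -- Let D J = H₁ (J ∪ {2, 3}) - H₂ (J ∪ {2, 3}), which is H₁ (J ∪ {2}) - H₂ (J ∪ {3}) by `hsum`.
    -- The claim D ∅ - D {0} = D {1} - D {0, 1} then follows from `hU` and `hV`.
    linarith
  refine ⟨Ω, mΩ, μ, inferInstance, fun ω => party e 0 (D ω), fun ω => party e 1 (D ω),
    fun ω => party e 2 (D ω), fun ω => party e 3 (D ω), X, fun ω => (Y ω).1, fun ω => (Y ω).2,
    { measurable_U := hm 0
      measurable_V := hm 1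
      measurable_W₁ := hm 2
      measurable_W₂ := hm 3
      measurable_X := h.measurable_X
      measurable_Y₁ := hY₁
      measurable_Y₂ := hY₂
      markov := fun B hB x y => ?_
      indep := h.indepFun_party
      eq₁ := ?_
      eq₂ := ?_
      eq₃ := ?_
      eq₄ := ?_
      eq₅ := ?_
      eq₆ := ?_
      eq₇ := ?_
      eq₃_diff := hdiff }, ?_, ?_⟩
  · exact h.markov (g := fun z => (party e 0 z, party e 1 z, party e 2 z, party e 3 z))
      ((measurable_party he.measurable 0).prodMk ((measurable_party he.measurable 1).prodMk
        ((measurable_party he.measurable 2).prodMk (measurable_party he.measurable 3)))) hB x y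
  · rw [e₁, (info₁ (by decide) o12 0 (B := {0, 1, 2}) (by decide)).1]
    exact congrArg _ hU
  · rw [e₂, (info₂ (by decide) o03 1 (B := {0, 1, 3}) (by decide)).1]
    exact congrArg _ hV
  · refine condMutualInfo_eq_of_diff (hm 0) (hm 1) (hm 2) (hm 3) hY₁ hY₂ ?_ ?_ hdiff
    · rw [d₃.1]; exact ENNReal.ofReal_ne_top
    · rw [d₄.1]; exact ENNReal.ofReal_ne_top
  · rw [(info₁ (by decide) (o 2) 3 (B := {2, 3}) (by decide)).1,
      (info₂ (by decide) (o 3) 2 (B := {2, 3}) (by decide)).1, s₀]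
  · rw [(info₁ (by decide) o02 3 (B := {0, 2, 3}) (by decide)).1,
      (info₂ (by decide) o03 2 (B := {0, 2, 3}) (by decide)).1]
    exact congrArg _ s₁
  · rw [(info₁ (by decide) o12 3 (B := {1, 2, 3}) (by decide)).1,
      (info₂ (by decide) o13 2 (B := {1, 2, 3}) (by decide)).1]
    exact congrArg _ s₂
  · rw [(info₁ (by decide) ((o 0).prodMk o12) 3 (B := {0, 1, 2, 3}) (by decide)).1,
      (info₂ (by decide) ((o 0).prodMk o13) 2 (B := {0, 1, 2, 3}) (by decide)).1]
    exact congrArg _ s₃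
  · rw [e₁]; exact ENNReal.ofReal_le_ofReal hR₁
  · rw [e₂]; exact ENNReal.ofReal_le_ofReal hR₂

/-! ### Entropies on a finite probability space -/

section FiniteEntropy

open Classical in
/-- The average of `g` over the event `f = f ω`, times the probability of that event. -/
def fiberSum {Ω τ : Type*} [Fintype Ω] (q : Ω → ℝ) (f : Ω → τ) (g : Ω → ℝ) (ω : Ω) : ℝ :=
  ∑ ω', if f ω' = f ω then q ω' * g ω' else 0

/-- The probability of the event `f = f ω`. -/
def fiberProb {Ω τ : Type*} [Fintype Ω] (q : Ω → ℝ) (f : Ω → τ) (ω : Ω) : ℝ := fiberSum q f 1 ω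

/-- The conditional expectation of `g` given `f`. -/
def fiberAvg {Ω τ : Type*} [Fintype Ω] (q : Ω → ℝ) (f : Ω → τ) (g : Ω → ℝ) (ω : Ω) : ℝ :=
  fiberSum q f g ω / fiberProb q f ω

/-- The entropy of `f`. -/
def entropy {Ω τ : Type*} [Fintype Ω] (q : Ω → ℝ) (f : Ω → τ) : ℝ :=
  -∑ ω, q ω * Real.log (fiberProb q f ω)

variable {Ω τ σ : Type*} [Fintype Ω] {q : Ω → ℝ} {f : Ω → τ}

lemma fiberSum_congr {f' : Ω → σ} {ω : Ω} (h : ∀ ω', f ω' = f ω ↔ f' ω' = f' ω) (g : Ω → ℝ) :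
    fiberSum q f g ω = fiberSum q f' g ω := by
  classical
  refine Finset.sum_congr rfl fun ω' _ => ?_
  by_cases h' : f ω' = f ω
  · rw [if_pos h', if_pos ((h ω').1 h')]
  · rw [if_neg h', if_neg (mt (h ω').2 h')]

/-- As a sum over outcomes, the entropy depends only on the partition that the variable induces.
Different encodings of the same knowledge can thus be exchanged. -/
lemma entropy_congr {f' : Ω → σ} (h : ∀ ω ω', f ω' = f ω ↔ f' ω' = f' ω) :
    entropy q f = entropy q f' := by
  simp only [entropy, fiberProb, fiberSum_congr (h _)]

lemma fiberSum_of_eq (g : Ω → ℝ) {ω ω' : Ω} (h : f ω = f ω') :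
    fiberSum q f g ω = fiberSum q f g ω' := by
  rw [fiberSum, fiberSum, h]

lemma fiberSum_nonneg (hq : ∀ ω, 0 ≤ q ω) {g : Ω → ℝ} (hg : ∀ ω, 0 ≤ g ω) (ω : Ω) :
    0 ≤ fiberSum q f g ω :=
  Finset.sum_nonneg fun ω' _ => by
    split_ifs
    · exact mul_nonneg (hq ω') (hg ω')
    · exact le_rfl

lemma fiberProb_nonneg (hq : ∀ ω, 0 ≤ q ω) (ω : Ω) : 0 ≤ fiberProb q f ω :=
  fiberSum_nonneg hq (fun _ => zero_le_one) ω

lemma le_fiberProb (hq : ∀ ω, 0 ≤ q ω) (ω : Ω) : q ω ≤ fiberProb q f ω := by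
  classical
  have h := Finset.single_le_sum (f := fun ω' => if f ω' = f ω then q ω' * 1 else 0)
    (fun ω' _ => by split_ifs <;> simp [hq ω']) (Finset.mem_univ ω)
  simpa [fiberProb, fiberSum] using h

lemma fiberProb_pos (hq : ∀ ω, 0 ≤ q ω) {ω : Ω} (h : q ω ≠ 0) : 0 < fiberProb q f ω :=
  ((hq ω).lt_of_ne' h).trans_le (le_fiberProb hq ω)

/-- The defining property of the conditional expectation. -/
lemma sum_mul_fiberAvg (hq : ∀ ω, 0 ≤ q ω) (g : Ω → ℝ) {G : Ω → ℝ}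
    (hG : ∀ ω ω', f ω = f ω' → G ω = G ω') :
    ∑ ω, q ω * (fiberAvg q f g ω * G ω) = ∑ ω, q ω * (g ω * G ω) := by
  classical
  have h₁ : ∀ ω, q ω * (fiberAvg q f g ω * G ω) =
      ∑ ω', if f ω' = f ω then q ω' * g ω' * G ω' * (q ω / fiberProb q f ω') else 0 := by
    intro ω
    rw [fiberAvg, fiberSum, Finset.sum_div, Finset.sum_mul, Finset.mul_sum]
    refine Finset.sum_congr rfl fun ω' _ => ?_
    split_ifs with h
    · have hp : fiberProb q f ω' = fiberProb q f ω := fiberSum_of_eq _ h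
      rw [hG ω' ω h, hp]
      ring
    · simp
  rw [Finset.sum_congr rfl fun ω _ => h₁ ω, Finset.sum_comm]
  refine Finset.sum_congr rfl fun ω' _ => ?_
  -- A fibre of probability 0 would produce 0 / 0, but there `q ω'` vanishes too.
  by_cases h0 : q ω' = 0
  · simp [h0]
  have h₂ : ∑ ω, (if f ω' = f ω then q ω' * g ω' * G ω' * (q ω / fiberProb q f ω') else 0) =
      q ω' * g ω' * G ω' * (fiberProb q f ω' / fiberProb q f ω') := by
    nth_rewrite 2 [fiberProb]
    rw [fiberSum, Finset.sum_div, Finset.mul_sum]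
    refine Finset.sum_congr rfl fun ω _ => ?_
    simp only [eq_comm (a := f ω')]
    split_ifs <;> simp
  rw [h₂, div_self (fiberProb_pos hq h0).ne']
  ring

open Classical in
/-- `H(B | f) = H(f, B) - H(f)`. -/
lemma sum_negMulLog_fiberAvg {β : Type*} [Fintype β] (hq : ∀ ω, 0 ≤ q ω) (B : Ω → β) :
    ∑ ω, q ω * ∑ b, Real.negMulLog (fiberAvg q f (fun ω' => if B ω' = b then 1 else 0) ω) =
      entropy q (fun ω => (f ω, B ω)) - entropy q f := by
  have hb : ∀ b, ∑ ω, q ω * Real.negMulLog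
      (fiberAvg q f (fun ω' => if B ω' = b then 1 else 0) ω) =
      ∑ ω, q ω * ((if B ω = b then 1 else 0) *
        -Real.log (fiberAvg q f (fun ω' => if B ω' = b then 1 else 0) ω)) := by
    intro b
    rw [← sum_mul_fiberAvg (f := f) hq]
    · refine Finset.sum_congr rfl fun ω _ => ?_
      rw [Real.negMulLog]
      ring
    · intro ω ω' h
      simp only [fiberAvg, fiberProb, fiberSum_of_eq _ h]
  simp_rw [Finset.mul_sum]
  rw [Finset.sum_comm, Finset.sum_congr rfl fun b _ => hb b, Finset.sum_comm, entropy, entropy,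
    sub_neg_eq_add, ← Finset.sum_neg_distrib, ← Finset.sum_add_distrib]
  refine Finset.sum_congr rfl fun ω _ => ?_
  by_cases h0 : q ω = 0
  · simp [h0]
  have hfib : fiberAvg q f (fun ω' => if B ω' = B ω then 1 else 0) ω =
      fiberProb q (fun ω => (f ω, B ω)) ω / fiberProb q f ω := by
    rw [fiberAvg]
    congr 1
    refine Finset.sum_congr rfl fun ω' _ => ?_
    by_cases h₁ : f ω' = f ω <;> by_cases h₂ : B ω' = B ω <;> simp [h₁, h₂]
  rw [Finset.sum_eq_single_of_mem (B ω) (Finset.mem_univ _) fun b _ hb => by simp [hb.symm],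
    hfib, Real.log_div (fiberProb_pos hq h0).ne' (fiberProb_pos hq h0).ne', if_pos rfl]
  ring

/-- A finer variable has a larger entropy. -/
lemma entropy_le_of_finer (hq : ∀ ω, 0 ≤ q ω) {f' : Ω → σ}
    (h : ∀ ω ω', f' ω' = f' ω → f ω' = f ω) : entropy q f ≤ entropy q f' := by
  rw [entropy, entropy, neg_le_neg_iff]
  refine Finset.sum_le_sum fun ω _ => ?_
  by_cases h0 : q ω = 0
  · simp [h0]
  refine mul_le_mul_of_nonneg_left (Real.log_le_log (fiberProb_pos hq h0) ?_) (hq ω)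
  refine Finset.sum_le_sum fun ω' _ => ?_
  by_cases h₁ : f' ω' = f' ω
  · simp [h₁, h ω ω' h₁]
  · simp only [h₁, if_false]
    split_ifs <;> simp [hq ω']

open Classical in
/-- Fano's inequality: if `M` can be guessed from `f` then `H(M | f)` is small. -/
lemma entropy_prod_sub_le {ℳ : Type*} [Fintype ℳ] [Nonempty ℳ] (hq : ∀ ω, 0 ≤ q ω)
    (hq1 : ∑ ω, q ω = 1) (M : Ω → ℳ) (d : τ → ℳ) :
    entropy q (fun ω => (f ω, M ω)) - entropy q f ≤ Real.log 2 +
      (∑ ω, if d (f ω) ≠ M ω then q ω else 0) * Real.log (Fintype.card ℳ) := by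
  have hc : (1 : ℝ) ≤ Fintype.card ℳ := by exact_mod_cast Fintype.card_pos
  have hc0 : (0 : ℝ) < Fintype.card ℳ := by linarith
  -- A guess of M that trusts the decoder with weight 1/2 and is uniform otherwise. Its log-loss is
  -- at most log 2 after a correct decoding and log 2 + log |ℳ| after a wrong one, and by Gibbs'
  -- inequality the mean loss bounds H(M | f).
  let Q : τ → ℳ → ℝ := fun t m => (if d t = m then 1 / 2 else 0) + 1 / (2 * Fintype.card ℳ)
  have hQ0 : ∀ t m, 0 < Q t m := fun t m => by
    have : (0 : ℝ) < 1 / (2 * Fintype.card ℳ) := by positivity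
    simp only [Q]
    split_ifs <;> linarith
  have hQ1 : ∀ t, ∑ m, Q t m = 1 := fun t => by
    simp only [Q, Finset.sum_add_distrib, Finset.sum_ite_eq, Finset.mem_univ, if_true,
      Finset.sum_const, Finset.card_univ, nsmul_eq_mul]
    field_simp
    norm_num
  let r : Ω → ℝ := fiberProb q fun ω => (f ω, M ω)
  -- Up to pairs (t, m) that do not occur, this is the total mass of the law with first marginal
  -- that of f and conditional law `Q`.
  have hbound : ∑ ω, q ω * (fiberProb q f ω * Q (f ω) (M ω) / r ω) ≤ 1 := by
    have h₁ : ∀ ω, q ω * (fiberProb q f ω * Q (f ω) (M ω) / r ω) =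
        ∑ ω', if f ω' = f ω then q ω' * (q ω * Q (f ω') (M ω) / r ω) else 0 := by
      intro ω
      rw [fiberProb, fiberSum, Finset.sum_mul, Finset.sum_div, Finset.mul_sum]
      refine Finset.sum_congr rfl fun ω' _ => ?_
      split_ifs with h
      · rw [h, Pi.one_apply]; ring
      · simp
    rw [Finset.sum_congr rfl fun ω _ => h₁ ω, Finset.sum_comm, ← hq1]
    refine Finset.sum_le_sum fun ω' _ => ?_
    have h₂ : ∑ ω, (if f ω' = f ω then q ω' * (q ω * Q (f ω') (M ω) / r ω) else 0) =
        q ω' * ∑ m, Q (f ω') m * ∑ ω, if f ω = f ω' ∧ M ω = m then q ω / r ω else 0 := by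
      simp_rw [Finset.mul_sum]
      rw [Finset.sum_comm]
      refine Finset.sum_congr rfl fun ω _ => ?_
      by_cases h : f ω = f ω'
      · simp only [h, true_and, if_true, mul_ite, mul_zero, Finset.sum_ite_eq, Finset.mem_univ]
        ring
      · simp [h, Ne.symm h]
    rw [h₂]
    refine mul_le_of_le_one_right (hq ω') ?_
    rw [← hQ1 (f ω')]
    refine Finset.sum_le_sum fun m _ => mul_le_of_le_one_right (hQ0 _ m).le ?_
    by_cases hex : ∃ ω₀, f ω₀ = f ω' ∧ M ω₀ = m
    · obtain ⟨ω₀, hf₀, hm₀⟩ := hex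
      have hr₀ : r ω₀ = ∑ ω, if f ω = f ω' ∧ M ω = m then q ω else 0 :=
        Finset.sum_congr rfl fun ω _ => by simp [hf₀, hm₀]
      have h₃ : ∀ ω, (if f ω = f ω' ∧ M ω = m then q ω / r ω else 0) =
          (if f ω = f ω' ∧ M ω = m then q ω else 0) / r ω₀ := by
        intro ω
        split_ifs with h
        · have hr : r ω = r ω₀ :=
            fiberSum_of_eq _ (Prod.ext (h.1.trans hf₀.symm) (h.2.trans hm₀.symm))
          rw [hr]
        · simp
      rw [Finset.sum_congr rfl fun ω _ => h₃ ω, ← Finset.sum_div, ← hr₀]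
      exact div_self_le_one (r ω₀)
    · rw [Finset.sum_eq_zero fun ω _ => if_neg fun h => hex ⟨ω, h⟩]
      exact zero_le_one
  have hgibbs : ∑ ω, q ω * (Real.log (fiberProb q f ω) + Real.log (Q (f ω) (M ω)) -
      Real.log (r ω)) ≤ 0 := by
    have h₁ : ∀ ω, q ω * (Real.log (fiberProb q f ω) + Real.log (Q (f ω) (M ω)) -
        Real.log (r ω)) ≤ q ω * (fiberProb q f ω * Q (f ω) (M ω) / r ω) - q ω := by
      intro ω
      by_cases h0 : q ω = 0
      · simp [h0]
      have hp := fiberProb_pos (f := f) hq h0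
      have hr : 0 < r ω := fiberProb_pos hq h0
      rw [← Real.log_mul hp.ne' (hQ0 _ _).ne', ← Real.log_div
        (mul_pos hp (hQ0 _ _)).ne' hr.ne', ← mul_sub_one]
      exact mul_le_mul_of_nonneg_left
        (Real.log_le_sub_one_of_pos (div_pos (mul_pos hp (hQ0 _ _)) hr)) (hq ω)
    refine (Finset.sum_le_sum fun ω _ => h₁ ω).trans ?_
    rw [Finset.sum_sub_distrib, hq1]
    linarith
  have hlog : ∀ ω, q ω * -Real.log (Q (f ω) (M ω)) ≤ q ω * Real.log 2 +
      (if d (f ω) ≠ M ω then q ω else 0) * Real.log (Fintype.card ℳ) := by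
    intro ω
    by_cases h : d (f ω) = M ω
    · simp only [h, ne_eq, not_true_eq_false, if_false, zero_mul, add_zero]
      refine mul_le_mul_of_nonneg_left ?_ (hq ω)
      rw [neg_le, ← Real.log_inv]
      refine Real.log_le_log (by norm_num) ?_
      have : (0 : ℝ) < 1 / (2 * Fintype.card ℳ) := by positivity
      simp only [Q, h, if_true]
      norm_num at this ⊢
    · simp only [h, ne_eq, not_false_eq_true, if_true, Q, if_false, zero_add]
      rw [one_div, Real.log_inv, neg_neg, Real.log_mul two_ne_zero hc0.ne', mul_add]
  have h₄ := Finset.sum_le_sum fun ω (_ : ω ∈ Finset.univ) => hlog ω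
  rw [Finset.sum_add_distrib, ← Finset.sum_mul, ← Finset.sum_mul, hq1, one_mul] at h₄
  simp only [mul_sub, mul_add, Finset.sum_sub_distrib, Finset.sum_add_distrib] at hgibbs
  simp only [mul_neg, Finset.sum_neg_distrib] at h₄
  simp only [entropy]
  change -∑ ω, q ω * Real.log (r ω) - _ ≤ _
  linarith

end FiniteEntropy

/-! ### Finitely supported posteriors -/

section FiniteLaw

variable {𝒳 : Type*} [Fintype 𝒳] [Nonempty 𝒳]

/-- Coherence, tested on continuous functions only. -/
def WeaklyCoherent (P : Measure (Posteriors 𝒳)) : Prop :=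
  ∀ (A : Finset (Fin 4)) (x : 𝒳) (g : C(Posteriors 𝒳, ℝ)),
    ∫ κ, κ Finset.univ x * g (forget A κ) ∂P = ∫ κ, κ A x * g (forget A κ) ∂P

variable {Ω τ : Type*} [Fintype Ω]

open Classical in
/-- The conditional distribution of `X` given `f`. -/
def posterior (q : Ω → ℝ) (hq : ∀ ω, 0 ≤ q ω) (f : Ω → τ) (X : Ω → 𝒳) (ω : Ω) :
    stdSimplex ℝ 𝒳 :=
  if h : fiberProb q f ω = 0 then Classical.arbitrary _ else
    ⟨fun x => fiberAvg q f (fun ω' => if X ω' = x then 1 else 0) ω,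
      fun x => div_nonneg (fiberSum_nonneg hq (fun ω' => by split_ifs <;> simp) ω)
        (fiberProb_nonneg hq ω), by
      simp only [fiberAvg]
      rw [← Finset.sum_div, div_eq_one_iff_eq h, fiberProb]
      simp only [fiberSum]
      rw [Finset.sum_comm]
      refine Finset.sum_congr rfl fun ω' _ => ?_
      split_ifs <;> simp⟩

variable {q : Ω → ℝ} {hq : ∀ ω, 0 ≤ q ω} {f : Ω → τ} {X : Ω → 𝒳}

open Classical in
lemma posterior_apply {ω : Ω} (h : q ω ≠ 0) (x : 𝒳) :
    posterior q hq f X ω x = fiberAvg q f (fun ω' => if X ω' = x then 1 else 0) ω := by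
  rw [posterior, dif_neg (fiberProb_pos hq h).ne']
  rfl

lemma posterior_of_eq {ω ω' : Ω} (h : f ω = f ω') :
    posterior q hq f X ω = posterior q hq f X ω' := by
  have h₁ : fiberProb q f ω = fiberProb q f ω' := fiberSum_of_eq _ h
  have h₂ : ∀ g, fiberAvg q f g ω = fiberAvg q f g ω' := fun g => by
    rw [fiberAvg, fiberAvg, h₁, fiberSum_of_eq g h]
  unfold posterior
  simp only [h₁, h₂]

/-- Both sides are the mean of the indicator of X = x times G, since G is determined by f as well as
by f'. -/
lemma sum_mul_posterior_mul (hq : ∀ ω, 0 ≤ q ω) (x : 𝒳) {f' : Ω → τ} {G : Ω → ℝ}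
    (hG : ∀ ω ω', f ω = f ω' → G ω = G ω') (hG' : ∀ ω ω', f' ω = f' ω' → G ω = G ω') :
    ∑ ω, q ω * (posterior q hq f X ω x * G ω) = ∑ ω, q ω * (posterior q hq f' X ω x * G ω) := by
  classical
  have h : ∀ {f : Ω → τ}, (∀ ω ω', f ω = f ω' → G ω = G ω') →
      ∑ ω, q ω * (posterior q hq f X ω x * G ω) =
        ∑ ω, q ω * ((if X ω = x then 1 else 0) * G ω) := by
    intro f hG
    rw [← sum_mul_fiberAvg hq (fun ω => if X ω = x then 1 else 0) hG]
    refine Finset.sum_congr rfl fun ω _ => ?_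
    by_cases h0 : q ω = 0
    · simp [h0]
    · rw [posterior_apply h0]
  rw [h hG, h hG']

/-- A finitely supported distribution of posteriors. -/
def finiteLaw {𝒳 T : Type*} [Fintype 𝒳] [Fintype T] (a : T → ℝ) (κ : T → Posteriors 𝒳) :
    Measure (Posteriors 𝒳) :=
  ∑ t, ENNReal.ofReal (a t) • Measure.dirac (κ t)

lemma isProbabilityMeasure_finiteLaw {𝒳 T : Type*} [Fintype 𝒳] [Fintype T] {a : T → ℝ} (ha : ∀ t, 0 ≤ a t)
    (ha1 : ∑ t, a t = 1) (κ : T → Posteriors 𝒳) : IsProbabilityMeasure (finiteLaw a κ) :=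
  ⟨by simp [finiteLaw, ← ENNReal.ofReal_sum_of_nonneg fun t _ => ha t, ha1]⟩

lemma integral_finiteLaw {𝒳 T : Type*} [Fintype 𝒳] [Fintype T] {a : T → ℝ} (ha : ∀ t, 0 ≤ a t)
    (κ : T → Posteriors 𝒳) (g : Posteriors 𝒳 → ℝ) :
    ∫ x, g x ∂(finiteLaw a κ) = ∑ t, a t * g (κ t) := by
  rw [finiteLaw, integral_finsetSum_measure fun t _ =>
    (integrable_dirac (by simp)).smul_measure ENNReal.ofReal_ne_top]
  refine Finset.sum_congr rfl fun t _ => ?_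
  rw [integral_smul_measure, integral_dirac, ENNReal.toReal_ofReal (ha t), smul_eq_mul]

end FiniteLaw

/-! ### Memoryless channels -/

section Memoryless

variable {ι 𝒴 : Type*} [Fintype ι] [DecidableEq ι] [Fintype 𝒴]

/-- In a product distribution, coordinate `i` is independent of what does not depend on it. -/
lemma sum_prod_mul_of_update_eq {r : ι → 𝒴 → ℝ} (i : ι) (hr : ∑ b, r i b = 1)
    {G : (ι → 𝒴) → ℝ} (hG : ∀ y b, G (Function.update y i b) = G y) (g : 𝒴 → ℝ) :
    ∑ y : ι → 𝒴, (∏ j, r j (y j)) * (G y * g (y i)) =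
      (∑ b, r i b * g b) * ∑ y : ι → 𝒴, (∏ j, r j (y j)) * G y := by
  let s := (Equiv.funSplitAt i 𝒴).symm
  have hsi : ∀ b z, s (b, z) i = b := fun b z => by simp [s, Equiv.funSplitAt, Equiv.piSplitAt]
  have hsj : ∀ b z (j : {j // j ≠ i}), s (b, z) j = z j := fun b z j => by
    simp [s, Equiv.funSplitAt, Equiv.piSplitAt, j.2]
  have hprod : ∀ b z, ∏ j, r j (s (b, z) j) = r i b * ∏ j : {j // j ≠ i}, r j (z j) := by
    intro b z
    rw [Fintype.prod_eq_mul_prod_subtype_ne _ i, hsi]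
    simp only [hsj]
  have hGs : ∀ b b' z, G (s (b, z)) = G (s (b', z)) := by
    intro b b' z
    rw [← hG (s (b', z)) b]
    congr 1
    funext j
    by_cases h : j = i
    · subst h; simp [hsi]
    · rw [Function.update_of_ne h]
      exact (hsj b z ⟨j, h⟩).trans (hsj b' z ⟨j, h⟩).symm
  have key : ∀ g : 𝒴 → ℝ, ∑ y : ι → 𝒴, (∏ j, r j (y j)) * (G y * g (y i)) =
      ∑ z : {j // j ≠ i} → 𝒴, ∑ b, r i b * g b * ((∏ j : {j // j ≠ i}, r j (z j)) *
        G (s (b, z))) := by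
    intro g
    rw [← s.sum_comp, Fintype.sum_prod_type, Finset.sum_comm]
    refine Finset.sum_congr rfl fun z _ => Finset.sum_congr rfl fun b _ => ?_
    rw [hprod, hsi]
    ring
  have h1 := key fun _ => 1
  simp only [mul_one] at h1
  rw [key, h1, Finset.mul_sum]
  refine Finset.sum_congr rfl fun z _ => ?_
  rcases isEmpty_or_nonempty 𝒴 with hE | ⟨⟨b₀⟩⟩
  · simp
  simp only [hGs _ b₀, ← Finset.sum_mul]
  rw [hr, one_mul]

lemma sum_prod_eq_one {r : ι → 𝒴 → ℝ} (hr : ∀ i, ∑ b, r i b = 1) :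
    ∑ y : ι → 𝒴, ∏ j, r j (y j) = 1 := by
  rw [← Fintype.prod_sum]
  simp [hr]

end Memoryless

/-! ### The distribution induced by a code -/

section CodeLaw

variable {𝒳 𝒴₁ 𝒴₂ : Type*} {n M₁ M₂ : ℕ}

/-- The messages and the channel outputs. -/
abbrev Outcome (𝒴₁ 𝒴₂ : Type*) (n M₁ M₂ : ℕ) : Type _ :=
  Fin M₁ × Fin M₂ × (Fin n → 𝒴₁ × 𝒴₂)

/-- The input at time `i`. -/
def Code.input (c : Code 𝒳 𝒴₁ 𝒴₂ n M₁ M₂) (i : Fin n) (ω : Outcome 𝒴₁ 𝒴₂ n M₁ M₂) : 𝒳 :=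
  c.enc ω.1 ω.2.1 i

/-- The probability of an outcome when the code is used with independent uniform messages. -/
def Code.prob (c : Code 𝒳 𝒴₁ 𝒴₂ n M₁ M₂) (p : 𝒳 → PMF (𝒴₁ × 𝒴₂))
    (ω : Outcome 𝒴₁ 𝒴₂ n M₁ M₂) : ℝ :=
  (∏ j, (p (c.input j ω) (ω.2.2 j)).toReal) / (M₁ * M₂)

variable (c : Code 𝒳 𝒴₁ 𝒴₂ n M₁ M₂) (p : 𝒳 → PMF (𝒴₁ × 𝒴₂))

lemma Code.prob_nonneg (ω : Outcome 𝒴₁ 𝒴₂ n M₁ M₂) : 0 ≤ c.prob p ω :=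
  div_nonneg (Finset.prod_nonneg fun _ _ => ENNReal.toReal_nonneg) (by positivity)

variable [Fintype 𝒴₁] [Fintype 𝒴₂]

lemma Code.sum_prob_mul (F : Outcome 𝒴₁ 𝒴₂ n M₁ M₂ → ℝ) :
    ∑ ω, c.prob p ω * F ω = (∑ m₁, ∑ m₂, ∑ y : Fin n → 𝒴₁ × 𝒴₂,
      (∏ j, (p (c.enc m₁ m₂ j) (y j)).toReal) * F (m₁, m₂, y)) / (M₁ * M₂) := by
  rw [Fintype.sum_prod_type]
  simp_rw [Fintype.sum_prod_type, Finset.sum_div]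
  refine Finset.sum_congr rfl fun m₁ _ => Finset.sum_congr rfl fun m₂ _ =>
    Finset.sum_congr rfl fun y _ => ?_
  rw [Code.prob, div_mul_eq_mul_div]
  rfl

lemma Code.sum_prob_mul_message (F : Fin M₁ → Fin M₂ → ℝ) :
    ∑ ω, c.prob p ω * F ω.1 ω.2.1 = (∑ m₁, ∑ m₂, F m₁ m₂) / (M₁ * M₂) := by
  rw [c.sum_prob_mul p fun ω => F ω.1 ω.2.1]
  congr 1
  refine Finset.sum_congr rfl fun m₁ _ => Finset.sum_congr rfl fun m₂ _ => ?_
  simp only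
  rw [← Finset.sum_mul, sum_prod_eq_one fun i => sum_pmf_toReal _, one_mul]

lemma Code.sum_prob [NeZero M₁] [NeZero M₂] : ∑ ω, c.prob p ω = 1 := by
  have h := c.sum_prob_mul_message p fun _ _ => 1
  have h₁ : (M₁ : ℝ) ≠ 0 := NeZero.ne _
  have h₂ : (M₂ : ℝ) ≠ 0 := NeZero.ne _
  simp only [mul_one, Finset.sum_const, Finset.card_univ, Fintype.card_fin, nsmul_eq_mul] at h
  rw [h, div_self (mul_ne_zero h₁ h₂)]

lemma Code.errorProb_eq : c.errorProb p = ∑ ω, c.prob p ω *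
    if c.dec₁ (fun i => (ω.2.2 i).1) ≠ ω.1 ∨ c.dec₂ (fun i => (ω.2.2 i).2) ≠ ω.2.1 then 1
    else 0 := by
  rw [c.sum_prob_mul p, Code.errorProb]
  simp only [mul_ite, mul_one, mul_zero]

open Classical in
/-- Given the input at time `i`, the output at time `i` does not depend on the messages and on the
other outputs. -/
lemma Code.sum_prob_mul_output {β : Type*} (f : 𝒴₁ × 𝒴₂ → β) (i : Fin n) (b : β)
    {G : Outcome 𝒴₁ 𝒴₂ n M₁ M₂ → ℝ}
    (hG : ∀ m₁ m₂ y y₀, G (m₁, m₂, Function.update y i y₀) = G (m₁, m₂, y)) :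
    ∑ ω, c.prob p ω * (G ω * if f (ω.2.2 i) = b then 1 else 0) =
      ∑ ω, c.prob p ω * (G ω * marginal p f (c.input i ω) b) := by
  rw [c.sum_prob_mul p, c.sum_prob_mul p]
  congr 1
  refine Finset.sum_congr rfl fun m₁ _ => Finset.sum_congr rfl fun m₂ _ => ?_
  rw [sum_prod_mul_of_update_eq (r := fun j y => (p (c.enc m₁ m₂ j) y).toReal) i
    (sum_pmf_toReal _) (G := fun y => G (m₁, m₂, y)) (hG m₁ m₂)
    (fun y => if f y = b then 1 else 0)]
  have hm : ∑ y, (p (c.enc m₁ m₂ i) y).toReal * (if f y = b then 1 else 0) =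
      marginal p f (c.enc m₁ m₂ i) b := by
    unfold marginal
    refine Finset.sum_congr rfl fun y _ => ?_
    split_ifs <;> simp
  rw [hm, Finset.mul_sum]
  refine Finset.sum_congr rfl fun y _ => ?_
  simp only [Code.input]
  ring

open Classical in
-- `Code.sum_prob_mul_output` restricted to a fibre: if Z ignores the output at time `i`, the
-- posterior of that output is the channel applied to the posterior of the input.
lemma Code.fiberAvg_output [Fintype 𝒳] {β τ : Type*} (f : 𝒴₁ × 𝒴₂ → β) (i : Fin n) (b : β)
    {Z : Outcome 𝒴₁ 𝒴₂ n M₁ M₂ → τ}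
    (hZ : ∀ m₁ m₂ y y₀, Z (m₁, m₂, Function.update y i y₀) = Z (m₁, m₂, y))
    (ω : Outcome 𝒴₁ 𝒴₂ n M₁ M₂) :
    fiberAvg (c.prob p) Z (fun ω' => if f (ω'.2.2 i) = b then 1 else 0) ω =
      ∑ x, fiberAvg (c.prob p) Z (fun ω' => if c.input i ω' = x then 1 else 0) ω *
        marginal p f x b := by
  have h := c.sum_prob_mul_output p f i b (G := fun ω' => if Z ω' = Z ω then 1 else 0)
    (fun m₁ m₂ y y₀ => by simp only [hZ])
  simp only [fiberAvg, div_mul_eq_mul_div]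
  rw [← Finset.sum_div]
  congr 1
  simp only [fiberSum, Finset.sum_mul]
  rw [Finset.sum_comm]
  refine Eq.trans (Finset.sum_congr rfl fun ω' _ => ?_) (h.trans (Finset.sum_congr rfl
    fun ω' _ => ?_))
  · split_ifs <;> simp
  · by_cases hz : Z ω' = Z ω
    · simp [hz]
    · simp [hz]

end CodeLaw

/-! ### The posteriors of a code -/

section CodePosteriors

variable {𝒳 𝒴₁ 𝒴₂ : Type*} {n M₁ M₂ : ℕ}

/-- The messages selected by `J`, the outputs of the first receiver before time `a` and those of
the second receiver from time `b` on. -/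
def view (J : Finset (Fin 4)) (a b : ℕ) (ω : Outcome 𝒴₁ 𝒴₂ n M₁ M₂) :
    Option (Fin M₁) × Option (Fin M₂) × (Fin n → Option 𝒴₁) × (Fin n → Option 𝒴₂) :=
  (if 0 ∈ J then some ω.1 else none, if 1 ∈ J then some ω.2.1 else none,
    fun j => if j.val < a then some (ω.2.2 j).1 else none,
    fun j => if b ≤ j.val then some (ω.2.2 j).2 else none)

lemma view_eq_iff {J : Finset (Fin 4)} {a b : ℕ} {ω ω' : Outcome 𝒴₁ 𝒴₂ n M₁ M₂} :
    view J a b ω' = view J a b ω ↔ (0 ∈ J → ω'.1 = ω.1) ∧ (1 ∈ J → ω'.2.1 = ω.2.1) ∧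
      (∀ j : Fin n, j.val < a → (ω'.2.2 j).1 = (ω.2.2 j).1) ∧
      (∀ j : Fin n, b ≤ j.val → (ω'.2.2 j).2 = (ω.2.2 j).2) := by
  simp only [view, Prod.mk.injEq, funext_iff]
  refine and_congr ?_ (and_congr ?_ (and_congr (forall_congr' fun j => ?_)
    (forall_congr' fun j => ?_))) <;> split_ifs with h <;> simp [h]

/-- What the parties in `S` know at time `i`: party `0` knows the first message, party `1` the
second one, party `2` the past of the first output and party `3` the future of the second one. -/
def label (i : Fin n) (S : Finset (Fin 4)) (ω : Outcome 𝒴₁ 𝒴₂ n M₁ M₂) :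
    Option (Fin M₁) × Option (Fin M₂) × (Fin n → Option 𝒴₁) × (Fin n → Option 𝒴₂) :=
  -- Times start at 0. The cuts `0` and `n` reveal no output, and `i`, `i + 1` both leave out the
  -- output at time `i`.
  view S (if 2 ∈ S then i.val else 0) (if 3 ∈ S then i.val + 1 else n) ω

lemma label_update (i : Fin n) (S : Finset (Fin 4)) (m₁ : Fin M₁) (m₂ : Fin M₂)
    (y : Fin n → 𝒴₁ × 𝒴₂) (y₀ : 𝒴₁ × 𝒴₂) :
    label i S (m₁, m₂, Function.update y i y₀) = label i S (m₁, m₂, y) := by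
  refine view_eq_iff.2 ⟨fun _ => rfl, fun _ => rfl, fun j hj => ?_, fun j hj => ?_⟩
  · have : j ≠ i := by
      rintro rfl
      split_ifs at hj <;> omega
    simp [Function.update_of_ne this]
  · have : j ≠ i := by
      rintro rfl
      split_ifs at hj <;> omega
    simp [Function.update_of_ne this]

lemma label_eq_of_subset {i : Fin n} {S A : Finset (Fin 4)} (hSA : S ⊆ A)
    {ω ω' : Outcome 𝒴₁ 𝒴₂ n M₁ M₂} (h : label i A ω' = label i A ω) :
    label i S ω' = label i S ω := by
  obtain ⟨h₀, h₁, h₂, h₃⟩ := view_eq_iff.1 h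
  refine view_eq_iff.2 ⟨fun h => h₀ (hSA h), fun h => h₁ (hSA h), fun j hj => h₂ j ?_,
    fun j hj => h₃ j ?_⟩
  · by_cases hS : 2 ∈ S
    · simpa [hS, hSA hS] using hj
    · simp [hS] at hj
  · by_cases hS : 3 ∈ S
    · simpa [hS, hSA hS] using hj
    · have := j.2
      simp only [hS, if_false] at hj
      omega

variable [Fintype 𝒴₁] [Fintype 𝒴₂] (c : Code 𝒳 𝒴₁ 𝒴₂ n M₁ M₂) (p : 𝒳 → PMF (𝒴₁ × 𝒴₂))

/-- The entropy of a view. -/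
def Code.viewEntropy (J : Finset (Fin 4)) (a b : ℕ) : ℝ := entropy (c.prob p) (view J a b)

/-- The entropy of the messages. -/
lemma Code.viewEntropy_messages [NeZero M₁] [NeZero M₂] (J : Finset (Fin 4)) :
    c.viewEntropy p J 0 n =
      (if 0 ∈ J then Real.log M₁ else 0) + if 1 ∈ J then Real.log M₂ else 0 := by
  classical
  have h₁ : (M₁ : ℝ) ≠ 0 := NeZero.ne _
  have h₂ : (M₂ : ℝ) ≠ 0 := NeZero.ne _
  have hfib : ∀ ω, fiberProb (c.prob p) (view J 0 n) ω =
      ((if 0 ∈ J then (M₁ : ℝ) else 1) * if 1 ∈ J then (M₂ : ℝ) else 1)⁻¹ := by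
    intro ω
    have h := c.sum_prob_mul_message p fun m₁ m₂ =>
      (if 0 ∈ J → m₁ = ω.1 then 1 else 0) * if 1 ∈ J → m₂ = ω.2.1 then 1 else 0
    simp only [← Finset.mul_sum, ← Finset.sum_mul] at h
    refine Eq.trans (Finset.sum_congr rfl fun ω' _ => ?_) (h.trans ?_)
    · have hv : view J 0 n ω' = view J 0 n ω ↔
          (0 ∈ J → ω'.1 = ω.1) ∧ (1 ∈ J → ω'.2.1 = ω.2.1) := by
        rw [view_eq_iff]
        refine ⟨fun h => ⟨h.1, h.2.1⟩, fun h => ⟨h.1, h.2, fun j hj => absurd hj (by omega),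
          fun j hj => absurd j.2 (by omega)⟩⟩
      simp only [hv, Pi.one_apply]
      rw [ite_and]
      split_ifs <;> simp
    · by_cases ha : 0 ∈ J <;> by_cases hb : 1 ∈ J <;>
        simp [ha, hb, NeZero.ne M₁, NeZero.ne M₂] <;> field_simp
  rw [Code.viewEntropy, entropy]
  simp only [hfib]
  rw [← Finset.sum_mul, c.sum_prob p, one_mul, Real.log_inv, neg_neg]
  by_cases ha : 0 ∈ J <;> by_cases hb : 1 ∈ J <;> simp [ha, hb, Real.log_mul h₁ h₂]

/-- `view J n n` contains the whole first output block, so the difference is H(M₁ | Y₁ⁿ, J). Fano's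
inequality applies with the decoder ignoring the messages in `J`. -/
lemma Code.viewEntropy_insert_zero_mem_Icc [Nonempty 𝒴₁] [NeZero M₁] [NeZero M₂]
    (J : Finset (Fin 4)) :
    c.viewEntropy p (insert 0 J) n n - c.viewEntropy p J n n ∈
      Set.Icc 0 (Real.log 2 + c.errorProb p * Real.log M₁) := by
  classical
  have hM : (0 : ℝ) ≤ Real.log M₁ := Real.log_natCast_nonneg _
  refine ⟨sub_nonneg.2 (entropy_le_of_finer (c.prob_nonneg p) fun ω ω' h => ?_), ?_⟩
  · rw [view_eq_iff] at h ⊢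
    exact ⟨fun h' => h.1 (Finset.mem_insert_of_mem h'),
      fun h' => h.2.1 (Finset.mem_insert_of_mem h'), h.2.2⟩
  have hf := entropy_prod_sub_le (f := view J n n) (c.prob_nonneg p) (c.sum_prob p)
    (fun ω => ω.1) fun v => c.dec₁ fun j => (v.2.2.1 j).getD (Classical.arbitrary _)
  have hent : entropy (c.prob p) (fun ω => (view J n n ω, ω.1)) =
      c.viewEntropy p (insert 0 J) n n := by
    refine entropy_congr fun ω ω' => ?_
    rw [Prod.mk.injEq, view_eq_iff, view_eq_iff]
    simp only [Finset.mem_insert, true_or, true_imp_iff, show (1 : Fin 4) ≠ 0 by decide, false_or]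
    tauto
  rw [hent, Fintype.card_fin] at hf
  refine hf.trans (add_le_add le_rfl (mul_le_mul_of_nonneg_right ?_ hM))
  rw [c.errorProb_eq p]
  refine Finset.sum_le_sum fun ω _ => ?_
  have hd : c.dec₁ (fun j => ((view J n n ω).2.2.1 j).getD (Classical.arbitrary _)) =
      c.dec₁ fun j => (ω.2.2 j).1 := by
    congr 1
    funext j
    simp [view]
  rw [hd]
  by_cases h : c.dec₁ (fun j => (ω.2.2 j).1) = ω.1
  · simp only [h, ne_eq, not_true_eq_false, if_false]
    exact mul_nonneg (c.prob_nonneg p ω) (by split_ifs <;> simp)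
  · simp [h]

/-- The same for the second receiver, whose whole block is visible in `view J 0 0`. -/
lemma Code.viewEntropy_insert_one_mem_Icc [Nonempty 𝒴₂] [NeZero M₁] [NeZero M₂]
    (J : Finset (Fin 4)) :
    c.viewEntropy p (insert 1 J) 0 0 - c.viewEntropy p J 0 0 ∈
      Set.Icc 0 (Real.log 2 + c.errorProb p * Real.log M₂) := by
  classical
  have hM : (0 : ℝ) ≤ Real.log M₂ := Real.log_natCast_nonneg _
  refine ⟨sub_nonneg.2 (entropy_le_of_finer (c.prob_nonneg p) fun ω ω' h => ?_), ?_⟩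
  · rw [view_eq_iff] at h ⊢
    exact ⟨fun h' => h.1 (Finset.mem_insert_of_mem h'),
      fun h' => h.2.1 (Finset.mem_insert_of_mem h'), h.2.2⟩
  have hf := entropy_prod_sub_le (f := view J 0 0) (c.prob_nonneg p) (c.sum_prob p)
    (fun ω => ω.2.1) fun v => c.dec₂ fun j => (v.2.2.2 j).getD (Classical.arbitrary _)
  have hent : entropy (c.prob p) (fun ω => (view J 0 0 ω, ω.2.1)) =
      c.viewEntropy p (insert 1 J) 0 0 := by
    refine entropy_congr fun ω ω' => ?_
    rw [Prod.mk.injEq, view_eq_iff, view_eq_iff]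
    simp only [Finset.mem_insert, true_or, true_imp_iff, show (0 : Fin 4) ≠ 1 by decide, false_or]
    tauto
  rw [hent, Fintype.card_fin] at hf
  refine hf.trans (add_le_add le_rfl (mul_le_mul_of_nonneg_right ?_ hM))
  rw [c.errorProb_eq p]
  refine Finset.sum_le_sum fun ω _ => ?_
  have hd : c.dec₂ (fun j => ((view J 0 0 ω).2.2.2 j).getD (Classical.arbitrary _)) =
      c.dec₂ fun j => (ω.2.2 j).2 := by
    simp [view]
  rw [hd]
  by_cases h : c.dec₂ (fun j => (ω.2.2 j).2) = ω.2.1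
  · simp only [h, ne_eq, not_true_eq_false, if_false]
    exact mul_nonneg (c.prob_nonneg p ω) (by split_ifs <;> simp)
  · simp [h]

variable [Fintype 𝒳] [Nonempty 𝒳]

/-- The posteriors of the input at time `i`. -/
def Code.posteriors (i : Fin n) (ω : Outcome 𝒴₁ 𝒴₂ n M₁ M₂) : Posteriors 𝒳 :=
  fun S => posterior (c.prob p) (c.prob_nonneg p) (label i S) (c.input i) ω

/-- The distribution of the posteriors at a uniformly distributed time. -/
def Code.law : Measure (Posteriors 𝒳) :=
  finiteLaw (fun t : Fin n × Outcome 𝒴₁ 𝒴₂ n M₁ M₂ => c.prob p t.2 / n)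
    fun t => c.posteriors p t.1 t.2

lemma Code.isProbabilityMeasure_law [NeZero n] [NeZero M₁] [NeZero M₂] :
    IsProbabilityMeasure (c.law p) := by
  have hn : (n : ℝ) ≠ 0 := NeZero.ne _
  have h0 : ∀ t : Fin n × Outcome 𝒴₁ 𝒴₂ n M₁ M₂, 0 ≤ c.prob p t.2 / n := fun t =>
    div_nonneg (c.prob_nonneg p t.2) (Nat.cast_nonneg n)
  have h1 : ∑ t : Fin n × Outcome 𝒴₁ 𝒴₂ n M₁ M₂, c.prob p t.2 / n = 1 := by
    rw [Fintype.sum_prod_type]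
    simp only [← Finset.sum_div, c.sum_prob p, Finset.sum_const, Finset.card_univ,
      Fintype.card_fin, nsmul_eq_mul]
    rw [mul_one, div_self hn]
  exact isProbabilityMeasure_finiteLaw h0 h1 _

lemma Code.integral_law (g : Posteriors 𝒳 → ℝ) :
    ∫ κ, g κ ∂(c.law p) = (∑ i, ∑ ω, c.prob p ω * g (c.posteriors p i ω)) / n := by
  have h0 : ∀ t : Fin n × Outcome 𝒴₁ 𝒴₂ n M₁ M₂, 0 ≤ c.prob p t.2 / n := fun t =>
    div_nonneg (c.prob_nonneg p t.2) (Nat.cast_nonneg n)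
  rw [Code.law, integral_finiteLaw h0, Fintype.sum_prod_type]
  simp only [div_mul_eq_mul_div, ← Finset.sum_div]

/-- At a fixed time the posteriors of the subsets of A are functions of the label of A, and the
tower property applies. The condition is linear in the law, so it survives averaging over times, and
no party needs to be given the time. -/
lemma Code.weaklyCoherent_law : WeaklyCoherent (c.law p) := by
  intro A x g
  rw [c.integral_law p, c.integral_law p]
  congr 1
  refine Finset.sum_congr rfl fun i _ => ?_
  have hforget : ∀ B, A ⊆ B → ∀ ω ω' : Outcome 𝒴₁ 𝒴₂ n M₁ M₂, label i B ω = label i B ω' →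
      g (forget A (c.posteriors p i ω)) = g (forget A (c.posteriors p i ω')) := by
    intro B hAB ω ω' h
    congr 1
    funext S
    by_cases hS : S ⊆ A
    · simp only [forget, hS, if_true, Code.posteriors]
      exact posterior_of_eq (label_eq_of_subset (hS.trans hAB) h)
    · simp [forget, hS]
  exact sum_mul_posterior_mul (c.prob_nonneg p) x (hforget _ (Finset.subset_univ A))
    (hforget _ subset_rfl)

/-- The mean entropy of an output given what the parties in `S` know. -/
def meanEntropy {𝒴 β : Type*} [Fintype 𝒴] [Fintype β] (p : 𝒳 → PMF 𝒴) (f : 𝒴 → β)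
    (P : Measure (Posteriors 𝒳)) (S : Finset (Fin 4)) : ℝ :=
  ∫ κ, outEntropy (marginal p f) (κ S) ∂P

lemma Code.meanEntropy_law {β : Type*} [Fintype β] (f : 𝒴₁ × 𝒴₂ → β) (S : Finset (Fin 4)) :
    meanEntropy p f (c.law p) S = (∑ i, (entropy (c.prob p) (fun ω => (label i S ω, f (ω.2.2 i))) -
      entropy (c.prob p) (label i S))) / n := by
  classical
  rw [meanEntropy, c.integral_law p]
  congr 1
  refine Finset.sum_congr rfl fun i _ => ?_
  rw [← sum_negMulLog_fiberAvg (c.prob_nonneg p) fun ω => f (ω.2.2 i)]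
  refine Finset.sum_congr rfl fun ω _ => ?_
  by_cases h0 : c.prob p ω = 0
  · simp [h0]
  congr 1
  rw [outEntropy]
  refine Finset.sum_congr rfl fun b _ => ?_
  rw [c.fiberAvg_output p f i b (label_update i S)]
  simp only [Code.posteriors, posterior_apply h0]

/-- Conditional entropies become increments of the array `viewEntropy J a b`: revealing Y₁ at time i
moves the first cut from i to i + 1. -/
lemma Code.meanEntropy_fst {S J : Finset (Fin 4)} (h2 : 2 ∈ S) (h0 : 0 ∈ S ↔ 0 ∈ J)
    (h1 : 1 ∈ S ↔ 1 ∈ J) : meanEntropy p Prod.fst (c.law p) S =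
      (∑ i ∈ Finset.range n, (c.viewEntropy p J (i + 1) (if 3 ∈ S then i + 1 else n) -
        c.viewEntropy p J i (if 3 ∈ S then i + 1 else n))) / n := by
  rw [c.meanEntropy_law p, ← Fin.sum_univ_eq_sum_range (fun i =>
    c.viewEntropy p J (i + 1) (if 3 ∈ S then i + 1 else n) -
      c.viewEntropy p J i (if 3 ∈ S then i + 1 else n))]
  congr 1
  refine Finset.sum_congr rfl fun i _ => congrArg₂ _ (entropy_congr fun ω ω' => ?_)
    (entropy_congr fun ω ω' => ?_)
  · simp only [Prod.mk.injEq, label, view_eq_iff, if_pos h2, h0, h1]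
    refine ⟨fun ⟨⟨ha, hb, hc, hd⟩, he⟩ => ⟨ha, hb, fun j hj => ?_, hd⟩,
      fun ⟨ha, hb, hc, hd⟩ => ⟨⟨ha, hb, fun j hj => hc j (by omega), hd⟩, hc i (by omega)⟩⟩
    rcases Nat.lt_succ_iff_lt_or_eq.1 hj with hj | hj
    · exact hc j hj
    · rw [Fin.ext hj]; exact he
  · simp only [label, view_eq_iff, if_pos h2, h0, h1]

/-- Revealing Y₂ at time i moves the second cut from i + 1 down to i. -/
lemma Code.meanEntropy_snd {S J : Finset (Fin 4)} (h3 : 3 ∈ S) (h0 : 0 ∈ S ↔ 0 ∈ J)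
    (h1 : 1 ∈ S ↔ 1 ∈ J) : meanEntropy p Prod.snd (c.law p) S =
      (∑ i ∈ Finset.range n, (c.viewEntropy p J (if 2 ∈ S then i else 0) i -
        c.viewEntropy p J (if 2 ∈ S then i else 0) (i + 1))) / n := by
  rw [c.meanEntropy_law p, ← Fin.sum_univ_eq_sum_range (fun i =>
    c.viewEntropy p J (if 2 ∈ S then i else 0) i -
      c.viewEntropy p J (if 2 ∈ S then i else 0) (i + 1))]
  congr 1
  refine Finset.sum_congr rfl fun i _ => congrArg₂ _ (entropy_congr fun ω ω' => ?_)
    (entropy_congr fun ω ω' => ?_)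
  · simp only [Prod.mk.injEq, label, view_eq_iff, if_pos h3, h0, h1]
    refine ⟨fun ⟨⟨ha, hb, hc, hd⟩, he⟩ => ⟨ha, hb, hc, fun j hj => ?_⟩,
      fun ⟨ha, hb, hc, hd⟩ => ⟨⟨ha, hb, hc, fun j hj => hd j (by omega)⟩, hd i le_rfl⟩⟩
    rcases Nat.lt_or_eq_of_le hj with hj | hj
    · exact hd j hj
    · rw [← Fin.ext hj]; exact he
  · simp only [label, view_eq_iff, if_pos h3, h0, h1]

/-- The increments along the edge b = n telescope to H(Y₁ⁿ | J). -/
lemma Code.meanEntropy_fst_past {J : Finset (Fin 4)} (hJ : J ⊆ {0, 1}) :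
    meanEntropy p Prod.fst (c.law p) (J ∪ {2}) =
      (c.viewEntropy p J n n - c.viewEntropy p J 0 n) / n := by
  have h3 : 3 ∉ J := fun h => absurd (hJ h) (by decide)
  rw [c.meanEntropy_fst p (J := J) (by simp) (by simp) (by simp)]
  simp [h3, Finset.sum_range_sub (fun i => c.viewEntropy p J i n)]

lemma Code.meanEntropy_snd_future {J : Finset (Fin 4)} (hJ : J ⊆ {0, 1}) :
    meanEntropy p Prod.snd (c.law p) (J ∪ {3}) =
      (c.viewEntropy p J 0 0 - c.viewEntropy p J 0 n) / n := by
  have h2 : 2 ∉ J := fun h => absurd (hJ h) (by decide)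
  rw [c.meanEntropy_snd p (J := J) (by simp) (by simp) (by simp)]
  simp [h2, Finset.sum_range_sub' (fun i => c.viewEntropy p J 0 i)]

/-- Csiszár's sum identity. -/
lemma Code.meanEntropy_sum_identity {J : Finset (Fin 4)} (hJ : J ⊆ {0, 1}) :
    meanEntropy p Prod.fst (c.law p) (J ∪ {2}) - meanEntropy p Prod.fst (c.law p) (J ∪ {2, 3}) =
      meanEntropy p Prod.snd (c.law p) (J ∪ {3}) -
        meanEntropy p Prod.snd (c.law p) (J ∪ {2, 3}) := by
  rw [c.meanEntropy_fst_past p hJ, c.meanEntropy_snd_future p hJ,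
    c.meanEntropy_fst p (S := J ∪ {2, 3}) (J := J) (by simp) (by simp) (by simp),
    c.meanEntropy_snd p (S := J ∪ {2, 3}) (J := J) (by simp) (by simp) (by simp)]
  have h := Finset.sum_range_sub (fun i => c.viewEntropy p J i i) n
  simp only [Finset.mem_union, Finset.mem_insert, Finset.mem_singleton, or_true, true_or, if_true]
  rw [← sub_div, ← sub_div]
  congr 1
  -- Each diagonal step from (i, i) to (i + 1, i + 1) passes through (i, i + 1). The diagonal
  -- telescopes to (n, n) minus (0, 0), which is also what the two edge sums leave, their common
  -- corner (0, n) cancelling.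
  have h' : ∑ i ∈ Finset.range n, (c.viewEntropy p J (i + 1) (i + 1) - c.viewEntropy p J i i) =
      ∑ i ∈ Finset.range n, (c.viewEntropy p J (i + 1) (i + 1) - c.viewEntropy p J i (i + 1)) -
        ∑ i ∈ Finset.range n, (c.viewEntropy p J i i - c.viewEntropy p J i (i + 1)) := by
    rw [← Finset.sum_sub_distrib]
    exact Finset.sum_congr rfl fun i _ => by ring
  linarith

end CodePosteriors

/-! ### The limit of long codes -/

section Limit

variable {𝒳 : Type*} [Fintype 𝒳]

lemma continuous_posterior_apply (A : Finset (Fin 4)) (x : 𝒳) :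
    Continuous fun κ : Posteriors 𝒳 => (κ A : 𝒳 → ℝ) x :=
  (continuous_apply x).comp (continuous_subtype_val.comp (continuous_apply A))

/-- Probability measures on a compact metrizable space are weakly compact. A limit along an
ultrafilter serves all continuous functions at once, without subsequences. -/
lemma exists_tendsto_integral (P : ℕ → ProbabilityMeasure (Posteriors 𝒳)) :
    ∃ Q : ProbabilityMeasure (Posteriors 𝒳), ∀ g : Posteriors 𝒳 → ℝ, Continuous g →
      Tendsto (fun k => ∫ κ, g κ ∂(P k : Measure (Posteriors 𝒳))) (hyperfilter ℕ)
        (𝓝 (∫ κ, g κ ∂(Q : Measure (Posteriors 𝒳)))) := by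
  refine ⟨((hyperfilter ℕ).map P).lim, fun g hg => ?_⟩
  have h : Tendsto P (hyperfilter ℕ) (𝓝 ((hyperfilter ℕ).map P).lim) := Ultrafilter.le_nhds_lim _
  exact ProbabilityMeasure.tendsto_iff_forall_integral_tendsto.1 h
    (BoundedContinuousFunction.mkOfCompact ⟨g, hg⟩)

variable [Nonempty 𝒳]

lemma continuous_forget (A : Finset (Fin 4)) : Continuous (forget (𝒳 := 𝒳) A) := by
  refine continuous_pi fun S => ?_
  by_cases h : S ⊆ A
  · simpa [forget, h] using continuous_apply S
  · simpa [forget, h] using continuous_const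

/-- Two finite measures that agree on continuous functions are equal. The continuous form passes to
weak limits; the measurable form is needed because the encoding of the secrets is merely measurable.
-/
lemma WeaklyCoherent.coherent {P : Measure (Posteriors 𝒳)} [IsProbabilityMeasure P]
    (hP : WeaklyCoherent P) : Coherent P := by
  intro A x f hf
  let ν : Finset (Fin 4) → Measure (Posteriors 𝒳) := fun B =>
    (P.withDensity fun κ => ENNReal.ofReal (κ B x)).map (forget A)
  have hm : ∀ B, Measurable fun κ : Posteriors 𝒳 => ENNReal.ofReal (κ B x) := fun B =>
    (measurable_posterior_apply B x).ennreal_ofReal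
  have hle : ∀ (B : Finset (Fin 4)) (κ : Posteriors 𝒳), ENNReal.ofReal (κ B x) ≤ 1 := by
    intro B κ
    rw [← sum_ofReal_stdSimplex (κ B)]
    exact Finset.single_le_sum (f := fun x => ENNReal.ofReal (κ B x)) (fun _ _ => zero_le)
      (Finset.mem_univ x)
  have hfin : ∀ B, IsFiniteMeasure (ν B) := fun B => by
    have : IsFiniteMeasure (P.withDensity fun κ => ENNReal.ofReal (κ B x)) :=
      isFiniteMeasure_withDensity (ne_top_of_le_ne_top ENNReal.one_ne_top
        ((lintegral_mono (hle B)).trans (by simp)))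
    exact Measure.isFiniteMeasure_map _ _
  have hlint : ∀ B, ∫⁻ κ, f κ ∂(ν B) = ∫⁻ κ, ENNReal.ofReal (κ B x) * f (forget A κ) ∂P := by
    intro B
    rw [lintegral_map hf (measurable_forget A)]
    exact lintegral_withDensity_eq_lintegral_mul _ (hm B) (hf.comp (measurable_forget A))
  have hint : ∀ B (g : C(Posteriors 𝒳, ℝ)),
      ∫ κ, g κ ∂(ν B) = ∫ κ, κ B x * g (forget A κ) ∂P := by
    intro B g
    rw [integral_map (measurable_forget A).aemeasurable g.continuous.aestronglyMeasurable,
      integral_withDensity_eq_integral_toReal_smul (hm B)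
        (ae_of_all _ fun κ => ENNReal.ofReal_lt_top)]
    refine integral_congr_ae (ae_of_all _ fun κ => ?_)
    have h0 : 0 ≤ (κ B : 𝒳 → ℝ) x := (κ B).2.1 x
    simp only [smul_eq_mul]
    rw [ENNReal.toReal_ofReal h0]
  have heq : ν Finset.univ = ν A := by
    have := hfin
    refine ext_of_forall_integral_eq_of_IsFiniteMeasure fun g => ?_
    have := hP A x g.toContinuousMap
    rw [← hint, ← hint] at this
    exact this
  rw [← hlint, ← hlint, heq]

variable {𝒴₁ 𝒴₂ : Type*} [Fintype 𝒴₁] [Fintype 𝒴₂] {p : 𝒳 → PMF (𝒴₁ × 𝒴₂)}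


/-- The posteriors `P` satisfy the conditions of the outer bound for the rate pair `R` up to `η`. -/
structure ApproxAdmissible (p : 𝒳 → PMF (𝒴₁ × 𝒴₂)) (R : ℝ × ℝ) (η : ℝ)
    (P : Measure (Posteriors 𝒳)) : Prop where
  weaklyCoherent : WeaklyCoherent P
  sum_identity : ∀ J ⊆ {0, 1},
    meanEntropy p Prod.fst P (J ∪ {2}) - meanEntropy p Prod.fst P (J ∪ {2, 3}) =
      meanEntropy p Prod.snd P (J ∪ {3}) - meanEntropy p Prod.snd P (J ∪ {2, 3})
  abs_fst_le : |meanEntropy p Prod.fst P {2} - meanEntropy p Prod.fst P {0, 2} -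
    (meanEntropy p Prod.fst P {1, 2} - meanEntropy p Prod.fst P {0, 1, 2})| ≤ η
  abs_snd_le : |meanEntropy p Prod.snd P {3} - meanEntropy p Prod.snd P {1, 3} -
    (meanEntropy p Prod.snd P {0, 3} - meanEntropy p Prod.snd P {0, 1, 3})| ≤ η
  rate_fst_le : R.1 - η ≤ meanEntropy p Prod.fst P {2} - meanEntropy p Prod.fst P {0, 2}
  rate_snd_le : R.2 - η ≤ meanEntropy p Prod.snd P {3} - meanEntropy p Prod.snd P {1, 3}

/-- Each condition is a closed one on integrals of continuous functions, so with vanishing error the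
approximate equalities become exact. -/
lemma ApproxAdmissible.tendsto {R : ℝ × ℝ} {η : ℕ → ℝ} (hη : Tendsto η atTop (𝓝 0))
    {P : ℕ → ProbabilityMeasure (Posteriors 𝒳)} (hP : ∀ k, ApproxAdmissible p R (η k) (P k)) :
    ∃ Q : ProbabilityMeasure (Posteriors 𝒳),
      ApproxAdmissible p R 0 (Q : Measure (Posteriors 𝒳)) := by
  obtain ⟨Q, hQ⟩ := exists_tendsto_integral P
  have hη' : Tendsto η (hyperfilter ℕ) (𝓝 0) := hη.mono_left Nat.hyperfilter_le_atTop
  have h₁ : ∀ S, Tendsto (fun k => meanEntropy p Prod.fst (P k : Measure (Posteriors 𝒳)) S)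
      (hyperfilter ℕ) (𝓝 (meanEntropy p Prod.fst (Q : Measure (Posteriors 𝒳)) S)) := fun S =>
    hQ _ (continuous_outEntropy_posterior _ S)
  have h₂ : ∀ S, Tendsto (fun k => meanEntropy p Prod.snd (P k : Measure (Posteriors 𝒳)) S)
      (hyperfilter ℕ) (𝓝 (meanEntropy p Prod.snd (Q : Measure (Posteriors 𝒳)) S)) := fun S =>
    hQ _ (continuous_outEntropy_posterior _ S)
  refine ⟨Q, fun A x g => ?_, fun J hJ => ?_, ?_, ?_, ?_, ?_⟩
  · have hg : ∀ B, Continuous fun κ : Posteriors 𝒳 => (κ B : 𝒳 → ℝ) x * g (forget A κ) := fun B =>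
      (continuous_posterior_apply B x).mul (g.continuous.comp (continuous_forget A))
    exact tendsto_nhds_unique (hQ _ (hg Finset.univ))
      ((hQ _ (hg A)).congr fun k => ((hP k).weaklyCoherent A x g).symm)
  · exact tendsto_nhds_unique ((h₁ _).sub (h₁ _))
      (((h₂ _).sub (h₂ _)).congr fun k => ((hP k).sum_identity J hJ).symm)
  · exact le_of_tendsto_of_tendsto' (((h₁ _).sub (h₁ _)).sub ((h₁ _).sub (h₁ _))).abs hη'
      fun k => (hP k).abs_fst_le
  · exact le_of_tendsto_of_tendsto' (((h₂ _).sub (h₂ _)).sub ((h₂ _).sub (h₂ _))).abs hη'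
      fun k => (hP k).abs_snd_le
  · exact le_of_tendsto_of_tendsto' (tendsto_const_nhds.sub hη') ((h₁ _).sub (h₁ _))
      fun k => (hP k).rate_fst_le
  · exact le_of_tendsto_of_tendsto' (tendsto_const_nhds.sub hη') ((h₂ _).sub (h₂ _))
      fun k => (hP k).rate_snd_le

/-- As the messages are independent and uniform, n times the difference of entropies for I(U; Y₁ |
W₁) is log M₁ - H(M₁ | Y₁ⁿ), and for I(U; Y₁ | V, W₁) it is log M₁ - H(M₁ | Y₁ⁿ, M₂). Both
equivocations lie between 0 and the Fano bound, hence so does the absolute value of their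
difference. The second receiver is symmetric. -/
lemma Code.approxAdmissible_law [Nonempty 𝒴₁] [Nonempty 𝒴₂] {n M₁ M₂ : ℕ} [NeZero n] [NeZero M₁]
    [NeZero M₂] (c : Code 𝒳 𝒴₁ 𝒴₂ n M₁ M₂) {R : ℝ × ℝ} {η : ℝ}
    (h₁ : (Real.log 2 + c.errorProb p * Real.log M₁) / n ≤ η)
    (h₂ : (Real.log 2 + c.errorProb p * Real.log M₂) / n ≤ η)
    (hR₁ : R.1 - η ≤ (Real.log M₁ - (Real.log 2 + c.errorProb p * Real.log M₁)) / n)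
    (hR₂ : R.2 - η ≤ (Real.log M₂ - (Real.log 2 + c.errorProb p * Real.log M₂)) / n) :
    ApproxAdmissible p R η (c.law p) := by
  have hn : (0 : ℝ) < n := Nat.cast_pos.2 (NeZero.pos n)
  have a₁ := c.viewEntropy_insert_zero_mem_Icc p ∅
  have a₂ := c.viewEntropy_insert_zero_mem_Icc p {1}
  have b₁ := c.viewEntropy_insert_one_mem_Icc p ∅
  have b₂ := c.viewEntropy_insert_one_mem_Icc p {0}
  have e₁ : meanEntropy p Prod.fst (c.law p) {2} = _ :=
    c.meanEntropy_fst_past p (J := ∅) (by decide)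
  have e₂ : meanEntropy p Prod.fst (c.law p) {0, 2} = _ :=
    c.meanEntropy_fst_past p (J := insert 0 ∅) (by decide)
  have e₃ : meanEntropy p Prod.fst (c.law p) {1, 2} = _ :=
    c.meanEntropy_fst_past p (J := {1}) (by decide)
  have e₄ : meanEntropy p Prod.fst (c.law p) {0, 1, 2} = _ :=
    c.meanEntropy_fst_past p (J := insert 0 {1}) (by decide)
  have f₁ : meanEntropy p Prod.snd (c.law p) {3} = _ :=
    c.meanEntropy_snd_future p (J := ∅) (by decide)
  have f₂ : meanEntropy p Prod.snd (c.law p) {1, 3} = _ :=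
    c.meanEntropy_snd_future p (J := insert 1 ∅) (by decide)
  have f₃ : meanEntropy p Prod.snd (c.law p) {0, 3} = _ :=
    c.meanEntropy_snd_future p (J := {0}) (by decide)
  -- `{0, 1, 3}` and `insert 1 {0} ∪ {3}` list their elements in different orders.
  have f₄ : meanEntropy p Prod.snd (c.law p) {0, 1, 3} = _ :=
    (congrArg _ (by decide)).trans (c.meanEntropy_snd_future p (J := insert 1 {0}) (by decide))
  rw [c.viewEntropy_messages p] at e₁ e₂ e₃ e₄ f₁ f₂ f₃ f₄
  simp only [Finset.mem_insert, Finset.mem_singleton, Finset.notMem_empty, or_false, or_true,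
    if_true, if_false, show (0 : Fin 4) ≠ 1 by decide, show (1 : Fin 4) ≠ 0 by decide,
    add_zero, zero_add, sub_zero] at e₁ e₂ e₃ e₄ f₁ f₂ f₃ f₄
  rw [div_le_iff₀ hn] at h₁ h₂
  refine ⟨c.weaklyCoherent_law p, fun J hJ => c.meanEntropy_sum_identity p hJ, ?_, ?_, ?_, ?_⟩
  · rw [e₁, e₂, e₃, e₄, ← sub_div, ← sub_div, ← sub_div, abs_div, abs_of_pos hn, div_le_iff₀ hn,
      abs_le]
    constructor <;> linarith [a₁.1, a₁.2, a₂.1, a₂.2]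
  · rw [f₁, f₂, f₃, f₄, ← sub_div, ← sub_div, ← sub_div, abs_div, abs_of_pos hn, div_le_iff₀ hn,
      abs_le]
    constructor <;> linarith [b₁.1, b₁.2, b₂.1, b₂.2]
  · rw [e₁, e₂, ← sub_div]
    refine hR₁.trans (div_le_div_of_nonneg_right ?_ hn.le)
    linarith [a₁.2]
  · rw [f₁, f₂, ← sub_div]
    refine hR₂.trans (div_le_div_of_nonneg_right ?_ hn.le)
    linarith [b₁.2]

lemma tendsto_log_ceil_exp_div {R : ℝ} (hR : 0 ≤ R) :
    Tendsto (fun n : ℕ => Real.log ⌈Real.exp (n * R)⌉₊ / n) atTop (𝓝 R) := by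
  have hlim : Tendsto (fun n : ℕ => R + Real.log 2 / n) atTop (𝓝 R) := by
    simpa using tendsto_const_nhds.add (tendsto_const_div_atTop_nhds_zero_nat (Real.log 2))
  refine tendsto_of_tendsto_of_tendsto_of_le_of_le' tendsto_const_nhds hlim ?_ ?_
  · filter_upwards [eventually_gt_atTop 0] with n hn
    have hn' : (0 : ℝ) < n := Nat.cast_pos.2 hn
    rw [le_div_iff₀ hn', mul_comm]
    calc (n : ℝ) * R = Real.log (Real.exp (n * R)) := (Real.log_exp _).symm
      _ ≤ _ := Real.log_le_log (Real.exp_pos _) (Nat.le_ceil _)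
  · filter_upwards [eventually_gt_atTop 0] with n hn
    have hn' : (0 : ℝ) < n := Nat.cast_pos.2 hn
    have h1 : 1 ≤ Real.exp (n * R) := Real.one_le_exp (by positivity)
    have h2 : (⌈Real.exp (n * R)⌉₊ : ℝ) ≤ Real.exp (n * R) * 2 := by
      linarith [Nat.ceil_lt_add_one (Real.exp_pos (n * R)).le]
    have h3 : (0 : ℝ) < ⌈Real.exp (n * R)⌉₊ := Nat.cast_pos.2 (Nat.ceil_pos.2 (Real.exp_pos _))
    have h4 := Real.log_le_log h3 h2
    rw [Real.log_mul (Real.exp_pos _).ne' two_ne_zero, Real.log_exp] at h4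
    rw [div_le_iff₀ hn', add_mul, div_mul_cancel₀ _ hn'.ne']
    linarith

lemma Achievable.exists_approxAdmissible [Nonempty 𝒴₁] [Nonempty 𝒴₂] {R : ℝ × ℝ}
    (h : Achievable p R.1 R.2) {η : ℝ} (hη : 0 < η) :
    ∃ P : ProbabilityMeasure (Posteriors 𝒳),
      ApproxAdmissible p R η (P : Measure (Posteriors 𝒳)) := by
  obtain ⟨h₁, h₂, c, hc⟩ := h
  have hlog : Tendsto (fun n : ℕ => Real.log 2 / n) atTop (𝓝 0) :=
    tendsto_const_div_atTop_nhds_zero_nat _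
  have hfano : ∀ {r : ℝ}, 0 ≤ r → Tendsto (fun n : ℕ =>
      (Real.log 2 + (c n).errorProb p * Real.log ⌈Real.exp (n * r)⌉₊) / n) atTop (𝓝 0) := by
    intro r hr
    have := hlog.add (hc.mul (tendsto_log_ceil_exp_div hr))
    rw [zero_mul, add_zero] at this
    exact this.congr fun n => by ring
  have hrate : ∀ {r : ℝ}, 0 ≤ r → Tendsto (fun n : ℕ => (Real.log ⌈Real.exp (n * r)⌉₊ -
      (Real.log 2 + (c n).errorProb p * Real.log ⌈Real.exp (n * r)⌉₊)) / n) atTop (𝓝 r) := by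
    intro r hr
    have := (tendsto_log_ceil_exp_div hr).sub (hfano hr)
    rw [sub_zero] at this
    exact this.congr fun n => by ring
  obtain ⟨n, hn, a₁, a₂, b₁, b₂⟩ := ((eventually_gt_atTop 0).and
    (((hfano h₁).eventually_le_const hη).and (((hfano h₂).eventually_le_const hη).and
      (((hrate h₁).eventually_const_le (sub_lt_self _ hη)).and
        ((hrate h₂).eventually_const_le (sub_lt_self _ hη)))))).exists
  have : NeZero n := ⟨hn.ne'⟩
  have : ∀ r : ℝ, NeZero ⌈Real.exp (n * r)⌉₊ := fun r => ⟨(Nat.ceil_pos.2 (Real.exp_pos _)).ne'⟩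
  exact ⟨⟨(c n).law p, (c n).isProbabilityMeasure_law p⟩,
    (c n).approxAdmissible_law a₁ a₂ b₁ b₂⟩

/-- The closure costs half of the slack in the rates and the code the other half. -/
lemma exists_approxAdmissible_of_mem_capacityRegion [Nonempty 𝒴₁] [Nonempty 𝒴₂] {R : ℝ × ℝ}
    (hR : R ∈ capacityRegion p) {η : ℝ} (hη : 0 < η) :
    ∃ P : ProbabilityMeasure (Posteriors 𝒳),
      ApproxAdmissible p R η (P : Measure (Posteriors 𝒳)) := by
  obtain ⟨R', hR', hd⟩ := Metric.mem_closure_iff.1 hR (η / 2) (half_pos hη)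
  obtain ⟨P, hP⟩ := Achievable.exists_approxAdmissible hR' (half_pos hη)
  rw [Prod.dist_eq, max_lt_iff, Real.dist_eq, Real.dist_eq] at hd
  have d₁ := (abs_lt.1 hd.1).2
  have d₂ := (abs_lt.1 hd.2).2
  exact ⟨P, hP.weaklyCoherent, hP.sum_identity, hP.abs_fst_le.trans (by linarith),
    hP.abs_snd_le.trans (by linarith), le_trans (by linarith) hP.rate_fst_le,
    le_trans (by linarith) hP.rate_snd_le⟩

end Limit

end BroadcastChannel

end

theorem lemma1 {𝒳 𝒴₁ 𝒴₂ : Type*}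
    [Fintype 𝒳] [Nonempty 𝒳] [MeasurableSpace 𝒳] [MeasurableSingletonClass 𝒳]
    [Fintype 𝒴₁] [Nonempty 𝒴₁] [MeasurableSpace 𝒴₁] [MeasurableSingletonClass 𝒴₁]
    [Fintype 𝒴₂] [Nonempty 𝒴₂] [MeasurableSpace 𝒴₂] [MeasurableSingletonClass 𝒴₂]
    (p : 𝒳 → PMF (𝒴₁ × 𝒴₂)) :
    BroadcastChannel.capacityRegion p ⊆ BroadcastChannel.outerRegion p := by
  intro R hR
  choose P hP using fun k : ℕ =>
    BroadcastChannel.exists_approxAdmissible_of_mem_capacityRegion hR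
      (η := 1 / ((k : ℝ) + 1)) (by positivity)
  obtain ⟨Q, hQ⟩ := BroadcastChannel.ApproxAdmissible.tendsto
    tendsto_one_div_add_atTop_nhds_zero_nat hP
  exact BroadcastChannel.mem_outerRegion_of_coherent hQ.weaklyCoherent.coherent
    (fun _ => rfl) (fun _ => rfl) hQ.sum_identity
    (sub_eq_zero.1 (abs_nonpos_iff.1 hQ.abs_fst_le))
    (sub_eq_zero.1 (abs_nonpos_iff.1 hQ.abs_snd_le))
    ((sub_zero R.1).symm.trans_le hQ.rate_fst_le) ((sub_zero R.2).symm.trans_le hQ.rate_snd_le)
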